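/- Let $\alpha>0$, $t\ge 0$ and $w(x,t)=(1-x^2)^{\alpha}e^{-t/x^2}$ for $x\in[-1,1]$. Let $P_n(x,t)$, $n=0,1,2,\ldots$, be the monic polynomials of degree $n$ orthogonal with respect to $w(\cdot,t)$ on $[-1,1]$, put $P_{-1}=0$, and let $h_n(t)=\int_{-1}^{1}P_n(x,t)^2w(x,t)\,dx$. Define $$R_n(t)=\frac{2t}{h_n(t)}\int_{-1}^{1}\frac{P_n(y,t)^2\,w(y,t)}{y^2}\,dy\quad(n\ge 0),\qquad r_n(t)=\frac{2t}{h_{n-1}(t)}\int_{-1}^{1}\frac{P_n(y,t)P_{n-1}(y,t)\,w(y,t)}{y^3}\,dy\quad(n\ge 1),$$ and $r_0(t)=0$ (in accordance with $P_{-1}=0$); for $t=0$ all $R_n$ and $r_n$ are understood to be $0$. Write $R_n=R_n(t)$, $r_n=r_n(t)$. Then, for every $n\ge 1$, $$(n+r_n)(n+2\alpha+r_n)(r_{n+1}+r_n)(r_n+r_{n-1})+2(-1)^n t\,r_n(2n-1+2\alpha+r_n+r_{n-1})(2n+1+2\alpha+r_{n+1}+r_n)=0$$ and $$\begin{aligned}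 &\Big\{\big[R_{n+1}R_n^4+2\big((2n+2\alpha+1)R_{n+1}-(-1)^nt(2n+2\alpha+3)\big)R_n^3\\ &\quad+\big((4n^2+4n(2\alpha+1)-2t^2+2(-1)^nt+2\alpha^2+4\alpha+1)R_{n+1}-2t(2n+2\alpha+3)(t+(-1)^n(3n+3\alpha+1))\big)R_n^2\\ &\quad+2t(2n+2\alpha+1)\big(((-1)^n-2t)R_{n+1}-(2n+2\alpha+3)(2t+(-1)^n(n+\alpha))\big)R_n\\ &\quad-2t^2(2n+2\alpha+1)^2(2n+2\alpha+3+R_{n+1})\big]R_{n-1}\\ &\quad+2t(2n+2\alpha-1)(2n+2\alpha+1+R_n)\big[(-1)^nR_{n+1}R_n^2+\big(((-1)^n(n+\alpha+1)-t)R_{n+1}-t(2n+2\alpha+3)\big)R_n\\ &\quad-t(2n+2\alpha+1)(2n+2\alpha+3+R_{n+1})\big]\Big\}^2\\ &=4\Big\{\big[(-1)^nt(2n+2\alpha-1)(2n+2\alpha+1+R_n)+\big((n+\alpha+(-1)^nt)R_n+(-1)^nt(2n+2\alpha+1)\big)R_{n-1}\big]^2-n(n+2\alpha)R_{n-1}^2R_n^2\Big\}\\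 &\quad\times\Big\{\big[(-1)^nt(2n+2\alpha+1)(2n+2\alpha+3+R_{n+1})-\big((n+\alpha+1-(-1)^nt)R_{n+1}-(-1)^nt(2n+2\alpha+3)\big)R_n\big]^2\\ &\qquad-(n+1)(n+2\alpha+1)R_n^2R_{n+1}^2\Big\}. \end{aligned}$$ The initial values are $r_0(t)=0$, $$r_1(t)=R_0(t)=\frac{2\sqrt t\left[\Gamma\left(\tfrac32+\alpha\right)\Phi\left(-\alpha,\tfrac12;-t\right)-(1+2\alpha)\sqrt t\,\Gamma(1+\alpha)\Phi\left(\tfrac12-\alpha,\tfrac32;-t\right)\right]}{\Gamma(1+\alpha)\Phi\left(-\tfrac12-\alpha,\tfrac12;-t\right)-2\sqrt t\,\Gamma\left(\tfrac32+\alpha\right)\Phi\left(-\alpha,\tfrac32;-t\right)},$$ $$R_1(t)=\frac{6t\left[(3+2\alpha)\Gamma(1+\alpha)\Phi\left(-\tfrac12-\alpha,\tfrac12;-t\right)-4\sqrt t\,\Gamma\left(\tfrac52+\alpha\right)\Phi\left(-\alpha,\tfrac32;-t\right)\right]}{3\Gamma(1+\alpha)\Phi\left(-\tfrac32-\alpha,-\tfrac12;-t\right)+8t\sqrt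 t\,\Gamma\left(\tfrac52+\alpha\right)\Phi\left(-\alpha,\tfrac52;-t\right)},$$ where both denominators are nonzero and $\Phi(a,c;z)=\sum_{k\ge0}\frac{(a)_k}{(c)_k}\frac{z^k}{k!}$ is the confluent hypergeometric function, with $(a)_k=a(a+1)\cdots(a+k-1)$. -/

import Mathlib

open Polynomial

noncomputable section

namespace SPJacobi

/-- The weight `w(x,t) = (1 - x²)^α e^{-t/x²}` on `[-1,1]`. Its value at the single point
`x = 0` (where Lean reads `t / 0` as `0`) plays no role, as `w` is only used under integrals. -/
def weight (α t x : ℝ) : ℝ := (1 - x ^ 2) ^ α * Real.exp (-(t / x ^ 2))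

/-- The bilinear form `⟨p, q⟩ = ∫_{-1}^{1} p(x) q(x) w(x,t) dx`. -/
def innerW (α t : ℝ) (p q : ℝ[X]) : ℝ :=
  ∫ x in (-1 : ℝ)..1, p.eval x * q.eval x * weight α t x

/-- The monic orthogonal polynomials `P_n(x,t)` for the weight `w(x,t)`, constructed by the
Gram–Schmidt process from the monomials; see `orthoPoly_monic`, `orthoPoly_natDegree`
and `innerW_orthoPoly_of_ne` below for their defining properties. -/
def orthoPoly (α t : ℝ) (n : ℕ) : ℝ[X] :=
  X ^ n - ∑ k : Fin n,
    C (innerW α t (X ^ n) (orthoPoly α t k) /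
        innerW α t (orthoPoly α t k) (orthoPoly α t k)) * orthoPoly α t k
termination_by n
decreasing_by all_goals exact k.isLt

/-- The squared norms `h_n(t) = ∫_{-1}^{1} P_n(x,t)² w(x,t) dx`. -/
def normSq (α t : ℝ) (n : ℕ) : ℝ := innerW α t (orthoPoly α t n) (orthoPoly α t n)

/-- `R_n(t) = (2t / h_n) ∫_{-1}^{1} P_n(y)² w(y) / y² dy`. For `t = 0` this is `0`. -/
def R (α t : ℝ) (n : ℕ) : ℝ :=
  2 * t / normSq α t n *
    ∫ y in (-1 : ℝ)..1, (orthoPoly α t n).eval y ^ 2 * weight α t y / y ^ 2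

/-- `r_n(t) = (2t / h_{n-1}) ∫_{-1}^{1} P_n(y) P_{n-1}(y) w(y) / y³ dy` for `n ≥ 1`, and
`r_0(t) = 0` (the convention `P_{-1} = 0`). For `t = 0` this is `0`. -/
def r (α t : ℝ) : ℕ → ℝ
  | 0 => 0
  | n + 1 => 2 * t / normSq α t n *
      ∫ y in (-1 : ℝ)..1,
        (orthoPoly α t (n + 1)).eval y * (orthoPoly α t n).eval y * weight α t y / y ^ 3

/-- The confluent hypergeometric function (Kummer's function)
`Φ(a, c; z) = ∑_{k ≥ 0} (a)_k / (c)_k · z^k / k!`, for real `a`, `c`, `z` with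
`c ≠ 0, -1, -2, …`; `(a)_k = a (a + 1) ⋯ (a + k - 1)`. The series converges for every `z`. -/
def Phi (a c z : ℝ) : ℝ :=
  ∑' k : ℕ, (ascPochhammer ℝ k).eval a / (ascPochhammer ℝ k).eval c * (z ^ k / (k.factorial : ℝ))

/-! Checks that `orthoPoly` is the sequence of monic orthogonal polynomials. -/

theorem weight_nonneg {α t x : ℝ} (hx : x ∈ Set.Icc (-1 : ℝ) 1) : 0 ≤ weight α t x := by
  have : 0 ≤ 1 - x ^ 2 := by nlinarith [hx.1, hx.2]
  exact mul_nonneg (Real.rpow_nonneg this _) (Real.exp_pos _).le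

theorem weight_pos {α t x : ℝ} (hx : x ∈ Set.Ioo (-1 : ℝ) 1) : 0 < weight α t x := by
  have : 0 < 1 - x ^ 2 := by nlinarith [hx.1, hx.2]
  exact mul_pos (Real.rpow_pos_of_pos this _) (Real.exp_pos _)

theorem weight_le_one {α t x : ℝ} (hα : 0 < α) (ht : 0 ≤ t) (hx : x ∈ Set.Icc (-1 : ℝ) 1) :
    weight α t x ≤ 1 := by
  have h0 : 0 ≤ 1 - x ^ 2 := by nlinarith [hx.1, hx.2]
  have h1 : 1 - x ^ 2 ≤ 1 := by nlinarith [sq_nonneg x]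
  have h2 : Real.exp (-(t / x ^ 2)) ≤ 1 := Real.exp_le_one_iff.2 (neg_nonpos.2 (by positivity))
  exact mul_le_one₀ (Real.rpow_le_one h0 h1 hα.le) (Real.exp_pos _).le h2

theorem intervalIntegrable_weight {α t : ℝ} (hα : 0 < α) (ht : 0 ≤ t) :
    IntervalIntegrable (weight α t) MeasureTheory.volume (-1) 1 := by
  have hm : Measurable (weight α t) := by unfold weight; fun_prop
  refine (intervalIntegrable_const (c := (1 : ℝ))).mono_fun hm.aestronglyMeasurable ?_
  refine (MeasureTheory.ae_restrict_iff' measurableSet_uIoc).2 (.of_forall fun x hx => ?_)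
  rw [Set.uIoc_of_le (by norm_num)] at hx
  have hx' : x ∈ Set.Icc (-1 : ℝ) 1 := ⟨hx.1.le, hx.2⟩
  beta_reduce
  rw [Real.norm_of_nonneg (weight_nonneg hx'), norm_one]
  exact weight_le_one hα ht hx'

theorem intervalIntegrable_mul_weight {α t : ℝ} (hα : 0 < α) (ht : 0 ≤ t) (p q : ℝ[X]) :
    IntervalIntegrable (fun x => p.eval x * q.eval x * weight α t x)
      MeasureTheory.volume (-1) 1 :=
  (intervalIntegrable_weight hα ht).continuousOn_mul (by fun_prop)

theorem innerW_comm (α t : ℝ) (p q : ℝ[X]) : innerW α t p q = innerW α t q p := by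
  simp only [innerW, mul_comm (p.eval _)]

theorem innerW_sub_left {α t : ℝ} (hα : 0 < α) (ht : 0 ≤ t) (p q s : ℝ[X]) :
    innerW α t (p - q) s = innerW α t p s - innerW α t q s := by
  simp only [innerW, eval_sub, sub_mul]
  exact intervalIntegral.integral_sub (intervalIntegrable_mul_weight hα ht _ _)
    (intervalIntegrable_mul_weight hα ht _ _)

theorem innerW_sum_left {α t : ℝ} (hα : 0 < α) (ht : 0 ≤ t) {ι : Type*} (u : Finset ι)
    (c : ι → ℝ) (p : ι → ℝ[X]) (s : ℝ[X]) :
    innerW α t (∑ k ∈ u, C (c k) * p k) s = ∑ k ∈ u, c k * innerW α t (p k) s := by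
  simp only [innerW, eval_finsetSum, eval_mul, eval_C, Finset.sum_mul]
  rw [intervalIntegral.integral_finsetSum]
  · refine Finset.sum_congr rfl fun k _ => ?_
    rw [← intervalIntegral.integral_const_mul]
    simp only [mul_assoc]
  · intro k _
    simpa only [mul_assoc] using (intervalIntegrable_mul_weight hα ht (p k) s).const_mul (c k)

theorem innerW_self_pos {α t : ℝ} (hα : 0 < α) (ht : 0 ≤ t) {p : ℝ[X]} (hp : p ≠ 0) :
    0 < innerW α t p p := by
  have hle : (-1 : ℝ) ≤ 1 := by norm_num
  have hnn : ∀ x ∈ Set.Ioc (-1 : ℝ) 1, 0 ≤ p.eval x * p.eval x * weight α t x := fun x hx =>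
    mul_nonneg (mul_self_nonneg _) (weight_nonneg ⟨hx.1.le, hx.2⟩)
  have hfin : {x : ℝ | p.IsRoot x}.Finite := p.finite_setOfPred_isRoot hp
  rw [innerW, intervalIntegral.integral_pos_iff_support_of_nonneg_ae'
    ((MeasureTheory.ae_restrict_iff' measurableSet_uIoc).2 (.of_forall fun x hx => by
      rw [Set.uIoc_of_le hle] at hx; exact hnn x hx))
    (intervalIntegrable_mul_weight hα ht p p)]
  refine ⟨by norm_num, ?_⟩
  have hsub : Set.Ioo (-1 : ℝ) 1 \ {x : ℝ | p.IsRoot x} ⊆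
      (Function.support fun x => p.eval x * p.eval x * weight α t x) ∩ Set.Ioc (-1) 1 := by
    rintro x ⟨hx, hr⟩
    refine ⟨?_, hx.1, hx.2.le⟩
    exact mul_ne_zero (mul_ne_zero hr hr) (weight_pos hx).ne'
  refine lt_of_lt_of_le ?_ (MeasureTheory.measure_mono hsub)
  rw [MeasureTheory.measure_sdiff_null (hfin.measure_zero _)]
  simp

theorem orthoPoly_monic_natDegree (α t : ℝ) (n : ℕ) :
    (orthoPoly α t n).Monic ∧ (orthoPoly α t n).natDegree = n := by
  induction n using Nat.strong_induction_on with
  | _ n ih =>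
    have hlt : (∑ k : Fin n,
        C (innerW α t (X ^ n) (orthoPoly α t k) /
          innerW α t (orthoPoly α t k) (orthoPoly α t k)) * orthoPoly α t k).degree < n := by
      refine lt_of_le_of_lt (degree_sum_le _ _) ((Finset.sup_lt_iff (WithBot.bot_lt_coe n)).2 ?_)
      intro k _
      rw [C_mul']
      refine lt_of_le_of_lt (degree_smul_le _ _) ?_
      rw [degree_eq_natDegree (ih k k.isLt).1.ne_zero, (ih k k.isLt).2]
      exact Nat.cast_lt.2 k.isLt
    rw [orthoPoly]
    refine ⟨monic_X_pow_sub hlt, ?_⟩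
    exact natDegree_eq_of_degree_eq_some
      ((degree_sub_eq_left_of_degree_lt (by rwa [degree_X_pow])).trans (degree_X_pow n))

theorem orthoPoly_monic (α t : ℝ) (n : ℕ) : (orthoPoly α t n).Monic :=
  (orthoPoly_monic_natDegree α t n).1

theorem orthoPoly_natDegree (α t : ℝ) (n : ℕ) : (orthoPoly α t n).natDegree = n :=
  (orthoPoly_monic_natDegree α t n).2

theorem normSq_pos {α t : ℝ} (hα : 0 < α) (ht : 0 ≤ t) (n : ℕ) : 0 < normSq α t n :=
  innerW_self_pos hα ht (orthoPoly_monic α t n).ne_zero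

theorem innerW_orthoPoly_of_lt {α t : ℝ} (hα : 0 < α) (ht : 0 ≤ t) (n : ℕ) :
    ∀ m < n, innerW α t (orthoPoly α t n) (orthoPoly α t m) = 0 := by
  induction n using Nat.strong_induction_on with
  | _ n ih =>
    intro m hm
    conv_lhs => rw [orthoPoly.eq_def α t n]
    rw [innerW_sub_left hα ht, innerW_sum_left hα ht,
      Finset.sum_eq_single (⟨m, hm⟩ : Fin n)]
    · have := (normSq_pos hα ht m).ne'
      rw [normSq] at this
      simp only
      field_simp
      simp
    · intro k _ hk
      have hne : (k : ℕ) ≠ m := fun h => hk (Fin.ext h)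
      rcases lt_or_gt_of_ne hne with h | h
      · rw [innerW_comm α t (orthoPoly α t k) (orthoPoly α t m), ih m hm k h, mul_zero]
      · rw [ih k k.isLt m h, mul_zero]
    · simp

theorem innerW_orthoPoly_of_ne {α t : ℝ} (hα : 0 < α) (ht : 0 ≤ t) {j k : ℕ} (hjk : j ≠ k) :
    innerW α t (orthoPoly α t j) (orthoPoly α t k) = 0 := by
  rcases lt_or_gt_of_ne hjk with h | h
  · rw [innerW_comm, innerW_orthoPoly_of_lt hα ht k j h]
  · exact innerW_orthoPoly_of_lt hα ht j k h

end SPJacobi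

end

/-! For t > 0 let L, Z, V, M integrate a polynomial against w, w/x², w/x³, w/(1-x²), and let h_n =
L(P_n²). Then R_n = 2t Z(P_n²)/h_n and r_{n+1} = 2t V(P_{n+1}P_n)/h_n. Three relations carry both
difference equations.

(1) R_n = r_{n+1} + r_n, by applying V to the three-term recurrence (`R_eq_add`). (2) h_{n+1}
R_{n+1} R_n = 2(-1)^n t r_{n+1} h_n (`normSq_mul_R_mul_R`). Dividing by X² at the double point 0
makes the Z-values factor into values at 0 and common constants (`Z_product`). (3) h_n
(n+1+r_{n+1})(n+1+2α+r_{n+1}) = h_{n+1} (2n+3+2α+R_{n+1})(2n+1+2α+R_n) (`normSq_mul_shifted`). The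
same factorization at the points ±1 gives `M_product`, and the Pearson equation w' = -2αx w/(1-x²) +
2t w/x³ turns the M-values into R and r.

Eliminating h_{n+1}/h_n from (2) and (3) gives `r_quadratic`, which with (1) is the equation for
r_n. It is also a quadratic in r_n with coefficients in R_{n-1}, R_n, and likewise for r_{n+1};
since r_n + r_{n+1} = R_n, both can be eliminated (`discriminant_relation`), which yields the
equation for R_n.

The initial values need only the moments of order 0, 2 and -2. With t = s², the functions F(s) = ∫ w
and J(s) = s ∫ w/x² satisfy F' = -2J, J' = -2sJ - (1+2α)F. The Kummer combinations `phiDen`,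
`phiNum` satisfy the same system by contiguous relations, and the data at s = 0 agree up to one
factor by a Beta and a Gaussian integral. Uniqueness (`eq_zero_of_linear_system`) identifies the two
pairs. At t = 0 all R_n and r_n vanish. -/

namespace SPJacobi

/-! ### Algebra of symmetric orthogonal polynomials. -/

/-- `P` is the sequence of monic orthogonal polynomials of a positive definite functional `L`
on real polynomials that vanishes on odd polynomials. -/
structure IsSymmOrtho (L : ℝ[X] →ₗ[ℝ] ℝ) (P : ℕ → ℝ[X]) : Prop where
  monic : ∀ n, (P n).Monic
  natDegree : ∀ n, (P n).natDegree = n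
  orth : ∀ n, ∀ m < n, L (P n * P m) = 0
  pos : ∀ p : ℝ[X], p ≠ 0 → 0 < L (p * p)
  odd : ∀ p : ℝ[X], p.comp (-X) = -p → L p = 0

theorem map_C_mul (L : ℝ[X] →ₗ[ℝ] ℝ) (c : ℝ) (p : ℝ[X]) : L (C c * p) = c * L p := by
  rw [← smul_eq_C_mul, map_smul, smul_eq_mul]

theorem comp_neg_X_coeff (p : ℝ[X]) (i : ℕ) : (p.comp (-X)).coeff i = (-1) ^ i * p.coeff i := by
  rw [show (-X : ℝ[X]) = C (-1) * X by simp, comp_C_mul_X_coeff, mul_comm]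

theorem coeff_eq_zero_of_parity {k i : ℕ} {g : ℝ[X]} (hg : g.comp (-X) = (-1) ^ k * g)
    (hi : (k + i) % 2 = 1) : g.coeff i = 0 := by
  have h := congrArg (fun q => q.coeff i) hg
  have h1 : ((-1 : ℝ[X]) ^ k * g).coeff i = (-1) ^ k * g.coeff i := by
    rw [show ((-1 : ℝ[X]) ^ k) = C ((-1) ^ k) by simp, coeff_C_mul]
  simp only [comp_neg_X_coeff, h1] at h
  rcases Nat.even_or_odd k with hk | hk
  · have hi' : Odd i := by grind
    rw [hk.neg_one_pow, hi'.neg_one_pow] at h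
    linarith
  · have hi' : Even i := by grind
    rw [hk.neg_one_pow, hi'.neg_one_pow] at h
    linarith

namespace IsSymmOrtho

variable {L : ℝ[X] →ₗ[ℝ] ℝ} {P : ℕ → ℝ[X]}

theorem ne_zero (h : IsSymmOrtho L P) (n : ℕ) : P n ≠ 0 := (h.monic n).ne_zero

theorem norm_pos (h : IsSymmOrtho L P) (n : ℕ) : 0 < L (P n * P n) := h.pos _ (h.ne_zero n)

theorem coeff_self (h : IsSymmOrtho L P) (n : ℕ) : (P n).coeff n = 1 := by
  have := (h.monic n).coeff_natDegree
  rwa [h.natDegree n] at this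

theorem map_mul_eq_zero (h : IsSymmOrtho L P) (n : ℕ) {g : ℝ[X]} (hg : g.degree < n) :
    L (P n * g) = 0 := by
  suffices H : ∀ m ≤ n, ∀ g : ℝ[X], g.degree < m → L (P n * g) = 0 from H n le_rfl g hg
  intro m
  induction m with
  | zero =>
    intro _ g hg
    have : g = 0 := by
      rw [← degree_eq_bot]
      simpa using hg
    simp [this]
  | succ m ih =>
    intro hm g hg
    have h1 : (g - C (g.coeff m) * P m).degree < m := by
      rw [degree_lt_iff_coeff_zero] at hg ⊢
      intro k hk
      rw [coeff_sub, coeff_C_mul]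
      rcases hk.eq_or_lt with rfl | hk
      · rw [h.coeff_self]; ring
      · rw [hg k hk, coeff_eq_zero_of_natDegree_lt (p := P m) (by rw [h.natDegree]; exact hk)]
        ring
    have h2 := ih (by omega) _ h1
    rw [show P n * (g - C (g.coeff m) * P m) = P n * g - C (g.coeff m) * (P n * P m) by ring,
      map_sub, map_C_mul, h.orth n m (by omega)] at h2
    linarith

theorem map_mul_eq_coeff (h : IsSymmOrtho L P) (n : ℕ) {g : ℝ[X]} (hg : g.natDegree ≤ n) :
    L (P n * g) = g.coeff n * L (P n * P n) := by
  have h1 : (g - C (g.coeff n) * P n).degree < n := by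
    rw [degree_lt_iff_coeff_zero]
    intro k hk
    rw [coeff_sub, coeff_C_mul]
    rcases hk.eq_or_lt with rfl | hk
    · rw [h.coeff_self]; ring
    · rw [coeff_eq_zero_of_natDegree_lt (p := P n) (by rw [h.natDegree]; exact hk),
        coeff_eq_zero_of_natDegree_lt (p := g) (by omega)]
      ring
  have h2 := h.map_mul_eq_zero n h1
  rw [show P n * (g - C (g.coeff n) * P n) = P n * g - C (g.coeff n) * (P n * P n) by ring,
    map_sub, map_C_mul] at h2
  linarith

theorem comp_neg_X_map (h : IsSymmOrtho L P) (p : ℝ[X]) : L (p.comp (-X)) = L p := by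
  have h1 := h.odd (p.comp (-X) - p) (by
    rw [sub_comp, comp_assoc]
    simp)
  rw [map_sub] at h1
  linarith

/-- The difference of the two sides has degree below n and, since L is invariant under x ↦ -x, is
orthogonal to itself; definiteness kills it. -/
theorem parity (h : IsSymmOrtho L P) (n : ℕ) : (P n).comp (-X) = (-1) ^ n * P n := by
  set D : ℝ[X] := (P n).comp (-X) - (-1) ^ n * P n with hD
  have hc : ((-1 : ℝ[X]) ^ n) = C ((-1) ^ n) := by simp
  have hdeg : D.degree < n := by
    rw [degree_lt_iff_coeff_zero]
    intro k hk
    rw [hD, hc, coeff_sub, coeff_C_mul, comp_neg_X_coeff]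
    rcases hk.eq_or_lt with rfl | hk
    · ring
    · rw [coeff_eq_zero_of_natDegree_lt (p := P n) (by rw [h.natDegree]; exact hk)]
      ring
  have hdeg' : (D.comp (-X)).degree < n := by
    rw [degree_lt_iff_coeff_zero] at hdeg ⊢
    intro k hk
    rw [comp_neg_X_coeff, hdeg k hk, mul_zero]
  have h0 : L (D * D) = 0 := by
    have e : D * D = (P n).comp (-X) * D - C ((-1) ^ n) * (P n * D) := by
      rw [hD, hc]; ring
    rw [e, map_sub, map_C_mul, h.map_mul_eq_zero n hdeg, ← h.comp_neg_X_map, mul_comp, comp_assoc]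
    simp only [neg_comp, X_comp, neg_neg, comp_X]
    rw [h.map_mul_eq_zero n hdeg']
    ring
  by_contra hne
  exact (h.pos D (fun hD0 => hne (sub_eq_zero.1 hD0))).ne' h0

theorem map_X_mul_sq (h : IsSymmOrtho L P) (n : ℕ) : L (X * P n * P n) = 0 := by
  refine h.odd _ ?_
  rw [mul_comp, mul_comp, h.parity, X_comp]
  have : ((-1 : ℝ[X]) ^ n) * (-1) ^ n = 1 := by rw [← mul_pow]; simp
  linear_combination (-X * P n * P n) * this

theorem eq_zero_of_degree_lt (h : IsSymmOrtho L P) {D : ℝ[X]} {n : ℕ} (hD : D.degree < n)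
    (H : ∀ g : ℝ[X], g.degree < n → L (D * g) = 0) : D = 0 := by
  by_contra hne
  exact (h.pos D hne).ne' (H D hD)

/-- The recurrence has no P_{n+1} term because L(X P_{n+1}²) = 0 by symmetry. -/
theorem three_term (h : IsSymmOrtho L P) (n : ℕ) :
    P (n + 2) = X * P (n + 1)
      - C (L (P (n + 1) * P (n + 1)) / L (P n * P n)) * P n := by
  set b := L (P (n + 1) * P (n + 1)) / L (P n * P n) with hb
  rw [← sub_eq_zero]
  refine h.eq_zero_of_degree_lt (n := n + 2) ?_ ?_
  · rw [degree_lt_iff_coeff_zero]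
    intro k hk
    obtain ⟨k, rfl⟩ : ∃ j, k = j + 1 := ⟨k - 1, by omega⟩
    rw [coeff_sub, coeff_sub, coeff_C_mul, coeff_X_mul,
      coeff_eq_zero_of_natDegree_lt (p := P n) (by rw [h.natDegree]; omega)]
    rcases hk.eq_or_lt with hk | hk
    · obtain rfl : k = n + 1 := by omega
      rw [h.coeff_self, h.coeff_self]; ring
    · rw [coeff_eq_zero_of_natDegree_lt (p := P (n + 2)) (by rw [h.natDegree]; omega),
        coeff_eq_zero_of_natDegree_lt (p := P (n + 1)) (by rw [h.natDegree]; omega)]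
      ring
  · intro g hg
    set c := g.coeff (n + 1)
    set g' := g - C c * P (n + 1) with hg'
    have h1 : g'.natDegree ≤ n := by
      rw [natDegree_le_iff_coeff_eq_zero]
      intro k hk
      rw [hg', coeff_sub, coeff_C_mul]
      rcases (Nat.succ_le_of_lt hk).eq_or_lt with rfl | hk
      · rw [h.coeff_self]; ring
      · rw [coeff_eq_zero_of_natDegree_lt (p := P (n + 1)) (by rw [h.natDegree]; omega),
          (degree_lt_iff_coeff_zero _ _).1 hg k (by omega)]
        ring
    have e : (P (n + 2) - (X * P (n + 1) - C b * P n)) * g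
        = P (n + 2) * g - C c * (X * P (n + 1) * P (n + 1)) - P (n + 1) * (X * g')
          + C b * (C c * (P (n + 1) * P n)) + C b * (P n * g') := by
      rw [hg']; ring
    have h2 : (X * g').natDegree ≤ n + 1 := by
      refine (natDegree_mul_le).trans ?_
      rw [natDegree_X]; omega
    rw [e]
    simp only [map_add, map_sub, map_C_mul]
    rw [h.map_mul_eq_zero (n + 2) (by exact_mod_cast hg), h.map_X_mul_sq, h.orth (n + 1) n (by omega),
      h.map_mul_eq_coeff (n + 1) h2, h.map_mul_eq_coeff n h1, coeff_X_mul, hb]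
    have := (h.norm_pos n).ne'
    field_simp
    ring

theorem zero_eq (h : IsSymmOrtho L P) : P 0 = 1 :=
  (h.monic 0).natDegree_eq_zero.1 (h.natDegree 0)

theorem one_eq (h : IsSymmOrtho L P) : P 1 = X := by
  have h1 := eq_X_add_C_of_natDegree_le_one (h.natDegree 1).le
  rw [h.coeff_self, coeff_eq_zero_of_parity (h.parity 1) (by norm_num)] at h1
  simpa using h1

/-! ### The functional divided by `1 - X ^ 2` -/

/-- Parity turns the zero at 1 into one at -1 as well, so g is a multiple of 1 - X². Then M becomes
L, which sees only the leading coefficient of the quotient. -/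
theorem map_of_eval_one {M : ℝ[X] →ₗ[ℝ] ℝ} (h : IsSymmOrtho L P)
    (hM : ∀ p, M ((1 - X ^ 2) * p) = L p) {k : ℕ} {g : ℝ[X]}
    (hp : g.comp (-X) = (-1) ^ k * g) (hd : g.natDegree ≤ k + 2) (h1 : g.eval 1 = 0) :
    M (P k * g) = -(g.coeff (k + 2) * L (P k * P k)) := by
  have h2 : g.eval (-1) = 0 := by
    have := congrArg (eval 1) hp
    rw [eval_comp, eval_mul, h1] at this
    simpa using this
  have hdvd : (X - C (1 : ℝ)) * (X - C (-1)) ∣ g :=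
    (isCoprime_X_sub_C_of_isUnit_sub (by norm_num)).mul_dvd
      (dvd_iff_isRoot.2 h1) (dvd_iff_isRoot.2 h2)
  obtain ⟨q, hq⟩ := hdvd
  have hq' : g = (1 - X ^ 2) * (-q) := by
    rw [hq]; simp only [map_one, map_neg]; ring
  have hmon : ((X - C (1 : ℝ)) * (X - C (-1))).Monic := (monic_X_sub_C _).mul (monic_X_sub_C _)
  have hqd : (-q).natDegree ≤ k := by
    rw [natDegree_neg]
    have : ((X - C (1 : ℝ)) * (X - C (-1)) * q).natDegree = 2 + q.natDegree ∨ q = 0 := by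
      by_cases h0 : q = 0
      · exact Or.inr h0
      · left
        rw [hmon.natDegree_mul' h0, (monic_X_sub_C _).natDegree_mul (monic_X_sub_C _)]
        simp only [natDegree_X_sub_C]
    rcases this with this | rfl
    · rw [← hq] at this; omega
    · simp
  have hc : g.coeff (k + 2) = -(-q).coeff k := by
    rw [hq', sub_mul, one_mul, coeff_sub, coeff_X_pow_mul,
      coeff_eq_zero_of_natDegree_lt (by omega : (-q).natDegree < k + 2)]
    ring
  have e : P k * g = (1 - X ^ 2) * (P k * (-q)) := by rw [hq']; ring
  rw [e, hM, h.map_mul_eq_coeff k hqd, hc]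
  ring

/-- The previous lemma applies to g - g(1) X^k, which has the parity of g. The constant M(P_k X^k)
is never computed; it cancels in `M_product`. -/
theorem map_eq_eval_one {M : ℝ[X] →ₗ[ℝ] ℝ} (h : IsSymmOrtho L P)
    (hM : ∀ p, M ((1 - X ^ 2) * p) = L p) {k : ℕ} {g : ℝ[X]}
    (hp : g.comp (-X) = (-1) ^ k * g) (hd : g.natDegree ≤ k + 2) :
    M (P k * g) = g.eval 1 * M (P k * X ^ k) - g.coeff (k + 2) * L (P k * P k) := by
  have h1 := h.map_of_eval_one hM (k := k) (g := g - C (g.eval 1) * X ^ k) ?_ ?_ ?_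
  · rw [show P k * (g - C (g.eval 1) * X ^ k) = P k * g - C (g.eval 1) * (P k * X ^ k) by ring,
      map_sub, map_C_mul, coeff_sub, coeff_C_mul_X_pow, if_neg (by omega)] at h1
    linarith
  · rw [sub_comp, hp, mul_comp, C_comp, X_pow_comp, neg_pow (X : ℝ[X])]; ring
  · refine (natDegree_sub_le _ _).trans (max_le hd ?_)
    refine (natDegree_C_mul_X_pow_le _ _).trans (by omega)
  · simp

/-- M(X P_{n+1} P_n) is evaluated twice, with P_{n+1} and with P_n as the orthogonal factor; only
the second evaluation produces the leading term -h_n. Both sides become the product of P_n(1),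
P_{n+1}(1) and the two unknown constants. -/
theorem M_product {M : ℝ[X] →ₗ[ℝ] ℝ} (h : IsSymmOrtho L P)
    (hM : ∀ p, M ((1 - X ^ 2) * p) = L p) (n : ℕ) :
    M (X * P (n + 1) * P n) * (M (X * P (n + 1) * P n) + L (P n * P n))
      = M (P (n + 1) * P (n + 1)) * M (P n * P n) := by
  have hdX : ∀ k, (X * P k).natDegree ≤ k + 1 := fun k => by
    refine natDegree_mul_le.trans ?_
    rw [natDegree_X, h.natDegree]; omega
  have hpX : ∀ k, (X * P k).comp (-X) = (-1) ^ (k + 1) * (X * P k) := fun k => by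
    rw [mul_comp, X_comp, h.parity]; ring
  have c0 : ∀ p : ℝ[X], ∀ k, p.natDegree < k → p.coeff k = 0 := fun p k hk =>
    coeff_eq_zero_of_natDegree_lt hk
  have e1 := h.map_eq_eval_one hM (h.parity (n + 1)) (by rw [h.natDegree]; omega)
  have e2 := h.map_eq_eval_one hM (k := n + 1) (hpX n) ((hdX n).trans (by omega))
  have e3 := h.map_eq_eval_one hM (h.parity n) (by rw [h.natDegree]; omega)
  have e4 := h.map_eq_eval_one hM (k := n) (g := X * P (n + 1)) (by rw [hpX]; ring)
    ((hdX (n + 1)).trans (by omega))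
  rw [c0 _ _ (by rw [h.natDegree]; omega)] at e1 e3
  rw [c0 _ _ (lt_of_le_of_lt (hdX n) (by omega))] at e2
  rw [coeff_X_mul, h.coeff_self] at e4
  rw [show P (n + 1) * (X * P n) = X * P (n + 1) * P n by ring] at e2
  rw [show P n * (X * P (n + 1)) = X * P (n + 1) * P n by ring] at e4
  simp only [eval_mul, eval_X, one_mul, zero_mul, sub_zero] at e1 e2 e3 e4
  have e5 : M (X * P (n + 1) * P n) + L (P n * P n) = eval 1 (P (n + 1)) * M (P n * X ^ n) := by
    linarith
  rw [e5, e1, e2, e3]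
  ring

/-! ### The functional divided by `X ^ 2` -/

/-- An even g has no linear term, so g - g(0) is a multiple of X², and the quotient has degree below
k. -/
theorem Z_even {Z : ℝ[X] →ₗ[ℝ] ℝ} (h : IsSymmOrtho L P) (hZ : ∀ p, Z (X ^ 2 * p) = L p)
    {k : ℕ} {g : ℝ[X]} (hg : g.comp (-X) = g) (hd : g.natDegree ≤ k + 1) :
    Z (P k * g) = g.coeff 0 * Z (P k) := by
  have hdvd : X ^ 2 ∣ g - C (g.coeff 0) := by
    rw [X_pow_dvd_iff]
    intro d hd
    rw [coeff_sub, coeff_C]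
    interval_cases d
    · simp
    · simp [coeff_eq_zero_of_parity (k := 0) (i := 1) (g := g) (by simpa using hg) (by norm_num)]
  obtain ⟨q, hq⟩ := hdvd
  have hqd : q.degree < k := by
    rw [degree_lt_iff_coeff_zero]
    intro m hm
    have := congrArg (fun p => p.coeff (m + 2)) hq
    simp only [coeff_X_pow_mul, coeff_sub, coeff_C_succ] at this
    rw [← this, coeff_eq_zero_of_natDegree_lt (by omega)]
    ring
  have e : P k * g = C (g.coeff 0) * P k + X ^ 2 * (P k * q) := by
    linear_combination (P k) * hq
  rw [e, map_add, map_C_mul, hZ, h.map_mul_eq_zero k hqd, add_zero]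

/-- Here the quotient of g - g(0) by X² is multiplied by X, so it can reach degree k and leave a
leading term. -/
theorem Z_odd {Z : ℝ[X] →ₗ[ℝ] ℝ} (h : IsSymmOrtho L P) (hZ : ∀ p, Z (X ^ 2 * p) = L p)
    {k : ℕ} {g : ℝ[X]} (hk : k ≠ 0) (hg : g.comp (-X) = g) (hd : g.natDegree ≤ k + 1) :
    Z (X * P k * g) = g.coeff 0 * Z (X * P k) + g.coeff (k + 1) * L (P k * P k) := by
  obtain ⟨k, rfl⟩ := Nat.exists_eq_succ_of_ne_zero hk
  have hdvd : X ^ 2 ∣ g - C (g.coeff 0) := by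
    rw [X_pow_dvd_iff]
    intro d hd
    rw [coeff_sub, coeff_C]
    interval_cases d
    · simp
    · simp [coeff_eq_zero_of_parity (k := 0) (i := 1) (g := g) (by simpa using hg) (by norm_num)]
  obtain ⟨q, hq⟩ := hdvd
  have hqc : ∀ m, q.coeff m = g.coeff (m + 2) := fun m => by
    have := congrArg (fun p => p.coeff (m + 2)) hq
    simp only [coeff_X_pow_mul, coeff_sub, coeff_C_succ] at this
    linarith
  have hqd : (X * q).natDegree ≤ k + 1 := by
    refine natDegree_mul_le.trans ?_
    have : q.natDegree ≤ k := by
      rw [natDegree_le_iff_coeff_eq_zero]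
      intro m hm
      rw [hqc, coeff_eq_zero_of_natDegree_lt (by omega)]
    rw [natDegree_X]
    omega
  have e : X * P (k + 1) * g
      = C (g.coeff 0) * (X * P (k + 1)) + X ^ 2 * (P (k + 1) * (X * q)) := by
    linear_combination (X * P (k + 1)) * hq
  rw [e, map_add, map_C_mul, hZ, h.map_mul_eq_coeff (k + 1) hqd, coeff_X_mul, hqc]

theorem exists_eq_X_mul (h : IsSymmOrtho L P) {k : ℕ} (hk : Odd k) :
    ∃ S : ℝ[X], P k = X * S ∧ S.comp (-X) = S ∧ S.natDegree + 1 = k ∧ S.coeff (k - 1) = 1 := by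
  have h0 : (P k).coeff 0 = 0 := coeff_eq_zero_of_parity (h.parity k) (by grind)
  obtain ⟨S, hS⟩ := X_dvd_iff.2 h0
  have hS0 : S ≠ 0 := by rintro rfl; exact h.ne_zero k (by simpa using hS)
  have hdeg : S.natDegree + 1 = k := by
    have := h.natDegree k
    rwa [hS, natDegree_X_mul hS0] at this
  refine ⟨S, hS, ?_, hdeg, ?_⟩
  · have := h.parity k
    rw [hS, mul_comp, X_comp, hk.neg_one_pow] at this
    have h2 : X * (S.comp (-X)) = X * S := by linear_combination -this
    exact mul_left_cancel₀ X_ne_zero h2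
  · have := h.coeff_self k
    rw [hS, ← hdeg, coeff_X_mul] at this
    rw [← hdeg]; simpa using this

/-- The odd one of P_n, P_{n+1} is written as X times an even polynomial. By `Z_even` and `Z_odd`
every term is then a value at 0 times Z of the even polynomial or Z of X times the odd one, and the
two sides match factor by factor. -/
theorem Z_product {Z V : ℝ[X] →ₗ[ℝ] ℝ} (h : IsSymmOrtho L P)
    (hZ : ∀ p, Z (X ^ 2 * p) = L p) (hV : ∀ p, V (X * p) = Z p) (n : ℕ) :
    Z (P (n + 1) * P (n + 1)) * Z (P n * P n)
      = (-1) ^ n * L (P n * P n) * V (P (n + 1) * P n) := by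
  rcases Nat.even_or_odd n with hn | hn
  · have hP := h.parity n
    rw [hn.neg_one_pow, one_mul] at hP
    obtain ⟨T, hT, hTp, hTd, hTc⟩ := h.exists_eq_X_mul hn.add_one
    have e1 : V (P (n + 1) * P n) = T.coeff 0 * Z (P n) := by
      rw [hT, show X * T * P n = X * (P n * T) by ring, hV, h.Z_even hZ hTp (by omega)]
    have e2 : Z (P n * P n) = (P n).coeff 0 * Z (P n) :=
      h.Z_even hZ hP (by rw [h.natDegree]; omega)
    have e3 : Z (P (n + 1) * P (n + 1)) = T.coeff 0 * Z (X * P (n + 1)) := by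
      have := h.Z_odd hZ (k := n + 1) (by omega) hTp (by omega)
      rw [coeff_eq_zero_of_natDegree_lt (by omega : T.natDegree < n + 1 + 1)] at this
      rw [show P (n + 1) * P (n + 1) = X * P (n + 1) * T by conv_lhs => enter [1]; rw [hT]
                                                            ring, this]
      ring
    have e4 : L (P n * P n) = (P n).coeff 0 * Z (X * P (n + 1)) := by
      have := h.Z_odd hZ (k := n + 1) (by omega) hP (by rw [h.natDegree]; omega)
      rw [coeff_eq_zero_of_natDegree_lt (by rw [h.natDegree]; omega : (P n).natDegree < n + 1 + 1),
        show X * P (n + 1) * P n = X ^ 2 * (P n * T) by rw [hT]; ring, hZ,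
        h.map_mul_eq_coeff n (by omega)] at this
      simp only [Nat.add_sub_cancel] at hTc
      rw [hTc] at this
      linarith
    rw [e1, e2, e3, hn.neg_one_pow, e4]
    ring
  · have hP := h.parity (n + 1)
    rw [hn.add_one.neg_one_pow, one_mul] at hP
    obtain ⟨S, hS, hSp, hSd, hSc⟩ := h.exists_eq_X_mul hn
    have hn0 : n ≠ 0 := by rintro rfl; simp at hn
    have e1 : V (P (n + 1) * P n) = S.coeff 0 * Z (P (n + 1)) := by
      rw [hS, show P (n + 1) * (X * S) = X * (P (n + 1) * S) by ring, hV,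
        h.Z_even hZ hSp (by omega)]
    have e2 : Z (P (n + 1) * P (n + 1)) = (P (n + 1)).coeff 0 * Z (P (n + 1)) :=
      h.Z_even hZ hP (by rw [h.natDegree]; omega)
    have e3 : Z (P n * P n) = S.coeff 0 * Z (X * P n) := by
      have := h.Z_odd hZ hn0 hSp (by omega)
      rw [coeff_eq_zero_of_natDegree_lt (by omega : S.natDegree < n + 1)] at this
      rw [show P n * P n = X * P n * S by conv_lhs => enter [1]; rw [hS]
                                          ring, this]
      ring
    -- The sign (-1)^n originates here: P_{n+1} has full degree n+1, so the leading term h_n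
    -- appears, while L(P_{n+1} S) = 0.
    have e4 : (P (n + 1)).coeff 0 * Z (X * P n) = - L (P n * P n) := by
      have := h.Z_odd hZ hn0 hP (by rw [h.natDegree])
      rw [h.coeff_self, show X * P n * P (n + 1) = X ^ 2 * (P (n + 1) * S) by rw [hS]; ring, hZ,
        h.map_mul_eq_zero (n + 1)] at this
      · linarith
      · exact degree_le_natDegree.trans_lt (by exact_mod_cast (by omega : S.natDegree < n + 1))
    rw [e1, e2, e3, hn.neg_one_pow]
    linear_combination S.coeff 0 * Z (P (n + 1)) * e4

/-! ### Consequences of the Pearson equation -/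

/-- Take f = X P_n² and replace X² by 1 - (1 - X²) under M. -/
theorem pearson_sq {Z V M : ℝ[X] →ₗ[ℝ] ℝ} {α t : ℝ} (h : IsSymmOrtho L P)
    (hM : ∀ p, M ((1 - X ^ 2) * p) = L p) (hV : ∀ p, V (X * p) = Z p)
    (hpe : ∀ f, L (derivative f) = 2 * α * M (X * f) - 2 * t * V f) (n : ℕ) :
    2 * α * M (P n * P n) = (2 * n + 1 + 2 * α) * L (P n * P n) + 2 * t * Z (P n * P n) := by
  have h1 := hpe (X * (P n * P n))
  have h2 : (X * derivative (P n)).natDegree ≤ n := by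
    rcases Nat.eq_zero_or_pos n with rfl | hn
    · rw [h.zero_eq]; simp
    · refine natDegree_mul_le.trans ?_
      have := natDegree_derivative_lt (p := P n) (by rw [h.natDegree]; omega)
      rw [h.natDegree] at this
      rw [natDegree_X]; omega
  have h3 : (X * derivative (P n)).coeff n = (n : ℝ) := by
    cases n with
    | zero => simp
    | succ n => rw [coeff_X_mul, coeff_derivative, h.coeff_self]; push_cast; ring
  have e : derivative (X * (P n * P n))
      = P n * P n + C 2 * (P n * (X * derivative (P n))) := by
    simp only [derivative_mul, derivative_X]
    rw [show (C 2 : ℝ[X]) = 2 from map_ofNat C 2]; ring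
  have e2 : X * (X * (P n * P n)) = P n * P n - (1 - X ^ 2) * (P n * P n) := by ring
  rw [e, e2, hV, map_add, map_C_mul, h.map_mul_eq_coeff n h2, h3, map_sub, hM] at h1
  linarith

/-- Take f = P_{n+1} P_n; only the term with P_{n+1}', of leading coefficient n+1, survives under L.
-/
theorem pearson_mul {V M : ℝ[X] →ₗ[ℝ] ℝ} {α t : ℝ} (h : IsSymmOrtho L P)
    (hpe : ∀ f, L (derivative f) = 2 * α * M (X * f) - 2 * t * V f) (n : ℕ) :
    2 * α * M (X * P (n + 1) * P n)
      = (n + 1) * L (P n * P n) + 2 * t * V (P (n + 1) * P n) := by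
  have h1 := hpe (P (n + 1) * P n)
  have h2 : (derivative (P (n + 1))).natDegree ≤ n := by
    have := natDegree_derivative_lt (p := P (n + 1)) (by rw [h.natDegree]; omega)
    rw [h.natDegree] at this
    omega
  have h3 : (derivative (P n)).degree < (n + 1 : ℕ) := by
    refine (degree_derivative_le).trans_lt ?_
    rw [degree_eq_natDegree (h.ne_zero n), h.natDegree]
    exact_mod_cast Nat.lt_succ_self n
  have e : derivative (P (n + 1) * P n)
      = P n * derivative (P (n + 1)) + P (n + 1) * derivative (P n) := by
    rw [derivative_mul]; ring
  rw [e, map_add, h.map_mul_eq_coeff n h2, h.map_mul_eq_zero (n + 1) h3, coeff_derivative,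
    h.coeff_self, show X * (P (n + 1) * P n) = X * P (n + 1) * P n by ring] at h1
  linarith

end IsSymmOrtho

end SPJacobi

/-! ### Elimination of r_n and r_{n+1}. -/

namespace SPJacobi

/-- Here A, B, D stand for R_{n-1}, R_n, R_{n+1} and e for (-1)^n. Each hypothesis is a quadratic
such as AB r² + 2U₀ r + N(N+2α)AB = 0. Completing the square, U = AB r + U₀ has U² equal to a
quarter of the discriminant, and similarly for V. The conclusion is (2UV)² = 4U²V². -/
theorem discriminant_relation {N e t α A B D r r' : ℝ} (hA : A ≠ 0) (hB : B ≠ 0) (hD : D ≠ 0)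
    (he : e = 1 ∨ e = -1)
    (h1 : (N + r) * (N + 2 * α + r) * B * A
      + 2 * e * t * r * (2 * N - 1 + 2 * α + A) * (2 * N + 1 + 2 * α + B) = 0)
    (h2 : (N + 1 + r') * (N + 1 + 2 * α + r') * D * B
      - 2 * e * t * r' * (2 * N + 1 + 2 * α + B) * (2 * N + 3 + 2 * α + D) = 0)
    (h3 : B = r' + r) :
    ((D * B ^ 4
          + 2 * ((2 * N + 2 * α + 1) * D
              - e * t * (2 * N + 2 * α + 3)) * B ^ 3
          + ((4 * N ^ 2 + 4 * N * (2 * α + 1) - 2 * t ^ 2 + 2 * e * t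
                + 2 * α ^ 2 + 4 * α + 1) * D
              - 2 * t * (2 * N + 2 * α + 3) * (t + e * (3 * N + 3 * α + 1))) * B ^ 2
          + 2 * t * (2 * N + 2 * α + 1)
              * ((e - 2 * t) * D
                - (2 * N + 2 * α + 3) * (2 * t + e * (N + α))) * B
          - 2 * t ^ 2 * (2 * N + 2 * α + 1) ^ 2 * (2 * N + 2 * α + 3 + D)) * A
        + 2 * t * (2 * N + 2 * α - 1) * (2 * N + 2 * α + 1 + B)
          * (e * D * B ^ 2
            + ((e * (N + α + 1) - t) * D - t * (2 * N + 2 * α + 3)) * B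
            - t * (2 * N + 2 * α + 1) * (2 * N + 2 * α + 3 + D))) ^ 2
      = 4 * ((e * t * (2 * N + 2 * α - 1) * (2 * N + 2 * α + 1 + B)
              + ((N + α + e * t) * B
                + e * t * (2 * N + 2 * α + 1)) * A) ^ 2
            - N * (N + 2 * α) * A ^ 2 * B ^ 2)
          * ((e * t * (2 * N + 2 * α + 1) * (2 * N + 2 * α + 3 + D)
              - ((N + α + 1 - e * t) * D
                - e * t * (2 * N + 2 * α + 3)) * B) ^ 2
            - (N + 1) * (N + 2 * α + 1) * B ^ 2 * D ^ 2) := by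
  obtain ⟨U₀, hU₀⟩ : ∃ U₀, U₀ = (N + α) * (A * B)
    + e * t * (2 * N - 1 + 2 * α + A) * (2 * N + 1 + 2 * α + B) := ⟨_, rfl⟩
  obtain ⟨V₀, hV₀⟩ : ∃ V₀, V₀ = (N + 1 + α) * (B * D)
    - e * t * (2 * N + 1 + 2 * α + B) * (2 * N + 3 + 2 * α + D) := ⟨_, rfl⟩
  obtain ⟨U, hU⟩ : ∃ U, U = A * B * r + U₀ := ⟨_, rfl⟩
  obtain ⟨V, hV⟩ : ∃ V, V = B * D * r' + V₀ := ⟨_, rfl⟩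
  have hU2 : (e * t * (2 * N + 2 * α - 1) * (2 * N + 2 * α + 1 + B)
      + ((N + α + e * t) * B + e * t * (2 * N + 2 * α + 1)) * A) ^ 2
      - N * (N + 2 * α) * A ^ 2 * B ^ 2 = U ^ 2 := by
    rw [hU, hU₀]; linear_combination -(A * B) * h1
  have hV2 : (e * t * (2 * N + 2 * α + 1) * (2 * N + 2 * α + 3 + D)
      - ((N + α + 1 - e * t) * D - e * t * (2 * N + 2 * α + 3)) * B) ^ 2
      - (N + 1) * (N + 2 * α + 1) * B ^ 2 * D ^ 2 = V ^ 2 := by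
    rw [hV, hV₀]; linear_combination -(B * D) * h2
  -- The combination U·BD + V·AB involves r and r' only through r + r' = B. Squaring it expresses
  -- the cross term 2UV through A, B, D; the factor AB·BD is nonzero and divides out.
  have key : 2 * (U * V) = (D * B ^ 4
          + 2 * ((2 * N + 2 * α + 1) * D
              - e * t * (2 * N + 2 * α + 3)) * B ^ 3
          + ((4 * N ^ 2 + 4 * N * (2 * α + 1) - 2 * t ^ 2 + 2 * e * t
                + 2 * α ^ 2 + 4 * α + 1) * D
              - 2 * t * (2 * N + 2 * α + 3) * (t + e * (3 * N + 3 * α + 1))) * B ^ 2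
          + 2 * t * (2 * N + 2 * α + 1)
              * ((e - 2 * t) * D
                - (2 * N + 2 * α + 3) * (2 * t + e * (N + α))) * B
          - 2 * t ^ 2 * (2 * N + 2 * α + 1) ^ 2 * (2 * N + 2 * α + 3 + D)) * A
        + 2 * t * (2 * N + 2 * α - 1) * (2 * N + 2 * α + 1 + B)
          * (e * D * B ^ 2
            + ((e * (N + α + 1) - t) * D - t * (2 * N + 2 * α + 3)) * B
            - t * (2 * N + 2 * α + 1) * (2 * N + 2 * α + 3 + D)) := by
    have hpq : (A * B) * (B * D) ≠ 0 := mul_ne_zero (mul_ne_zero hA hB) (mul_ne_zero hB hD)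
    refine mul_left_cancel₀ hpq ?_
    have e1 : A * B * (B * D) * (2 * (U * V))
        = (U * (B * D) + V * (A * B)) ^ 2 - U ^ 2 * (B * D) ^ 2 - V ^ 2 * (A * B) ^ 2 := by ring
    have e2 : U * (B * D) + V * (A * B)
        = (A * B) * (B * D) * B + (B * D) * U₀ + (A * B) * V₀ := by
      rw [hU, hV]; linear_combination -(A * B) * (B * D) * h3
    have e3 : U ^ 2 = U₀ ^ 2 - N * (N + 2 * α) * (A * B) ^ 2 := by
      rw [← hU2, hU₀]; ring
    have e4 : V ^ 2 = V₀ ^ 2 - (N + 1) * (N + 2 * α + 1) * (B * D) ^ 2 := by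
      rw [← hV2, hV₀]; ring
    have e5 : A * B * (B * D) * (2 * (U * V)) = A * B * (B * D) * (A * B * (B * D) * B ^ 2
        + 2 * B * (B * D * U₀ + A * B * V₀) + 2 * U₀ * V₀
        + (N * (N + 2 * α) + (N + 1) * (N + 2 * α + 1)) * (A * B * (B * D))) := by
      rw [e1, e2, e3, e4]; ring
    rw [e5]
    congr 1
    rw [hU₀, hV₀]
    -- The polynomial identity needs e² = 1.
    rcases he with rfl | rfl <;> ring
  rw [hU2, hV2, ← key]
  ring

end SPJacobi

/-! ### Integrability and integration by parts for the weight. -/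

namespace SPJacobi

open MeasureTheory intervalIntegral

/-- The functional `p ↦ ∫_{-1}^{1} p(x) u(x) dx` on polynomials. -/
noncomputable def polyIntegral (u : ℝ → ℝ) (hu : IntervalIntegrable u volume (-1) 1) :
    ℝ[X] →ₗ[ℝ] ℝ where
  toFun p := ∫ x in (-1 : ℝ)..1, p.eval x * u x
  map_add' p q := by
    simp only [eval_add, add_mul]
    exact integral_add (hu.continuousOn_mul (by fun_prop)) (hu.continuousOn_mul (by fun_prop))
  map_smul' c p := by
    simp only [eval_smul, smul_eq_mul, mul_assoc, intervalIntegral.integral_const_mul, RingHom.id_apply]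

theorem polyIntegral_apply (u : ℝ → ℝ) (hu : IntervalIntegrable u volume (-1) 1) (p : ℝ[X]) :
    polyIntegral u hu p = ∫ x in (-1 : ℝ)..1, p.eval x * u x := rfl

theorem integral_congr_off_countable {f g : ℝ → ℝ} {s : Set ℝ} (hs : s.Countable) {a b : ℝ}
    (h : ∀ x, x ∉ s → f x = g x) : ∫ x in a..b, f x = ∫ x in a..b, g x := by
  refine integral_congr_ae ?_
  filter_upwards [hs.ae_notMem volume] with x hx _ using h x hx

theorem polyIntegral_mul {u v : ℝ → ℝ} (hu : IntervalIntegrable u volume (-1) 1)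
    (hv : IntervalIntegrable v volume (-1) 1) (q : ℝ[X]) {s : Set ℝ} (hs : s.Countable)
    (h : ∀ x, x ∉ s → q.eval x * u x = v x) (p : ℝ[X]) :
    polyIntegral u hu (q * p) = polyIntegral v hv p := by
  simp only [polyIntegral_apply]
  refine integral_congr_off_countable hs fun x hx => ?_
  rw [← h x hx, eval_mul]
  ring

variable {α t : ℝ}

theorem measurable_weight : Measurable (weight α t) := by
  unfold weight; fun_prop

/-- From y^n/n! ≤ e^y at y = t/x²: for t > 0 the exponential absorbs every negative power of x. -/
theorem weight_div_pow_le (hα : 0 < α) (ht : 0 < t) {x : ℝ} (hx : x ∈ Set.Icc (-1 : ℝ) 1)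
    (n : ℕ) : weight α t x / x ^ (2 * n) ≤ n.factorial / t ^ n := by
  rcases n.eq_zero_or_pos with rfl | hn
  · simpa using weight_le_one hα ht.le hx
  rcases eq_or_ne x 0 with rfl | hx0
  · rw [zero_pow (by omega), div_zero]
    positivity
  have h0 : 0 ≤ 1 - x ^ 2 := by nlinarith [hx.1, hx.2]
  have h1 : 1 - x ^ 2 ≤ 1 := by nlinarith [sq_nonneg x]
  have hx2 : 0 < x ^ 2 := by positivity
  have h2 : Real.exp (-(t / x ^ 2)) ≤ n.factorial / t ^ n * x ^ (2 * n) := by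
    have := Real.pow_div_factorial_le_exp (x := t / x ^ 2) (by positivity) n
    rw [Real.exp_neg]
    refine (inv_anti₀ (by positivity) this).trans (le_of_eq ?_)
    rw [pow_mul, div_pow]
    field_simp
  rw [div_le_iff₀ (by rw [pow_mul]; positivity)]
  calc weight α t x ≤ 1 * Real.exp (-(t / x ^ 2)) :=
        mul_le_mul_of_nonneg_right (Real.rpow_le_one h0 h1 hα.le) (Real.exp_pos _).le
    _ ≤ _ := by rw [one_mul]; exact h2

theorem norm_weight_div_pow_le (hα : 0 < α) (ht : 0 < t) {x : ℝ} (hx : x ∈ Set.uIoc (-1 : ℝ) 1)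
    (n : ℕ) : ‖weight α t x / x ^ (2 * n)‖ ≤ n.factorial / t ^ n := by
  rw [Set.uIoc_of_le (by norm_num)] at hx
  have hx' : x ∈ Set.Icc (-1 : ℝ) 1 := ⟨hx.1.le, hx.2⟩
  rw [Real.norm_of_nonneg (div_nonneg (weight_nonneg hx') (by rw [pow_mul]; positivity))]
  exact weight_div_pow_le hα ht hx' n

theorem intervalIntegrable_weight_div_pow (hα : 0 < α) (ht : 0 < t) (n : ℕ) :
    IntervalIntegrable (fun x => weight α t x / x ^ (2 * n)) volume (-1) 1 := by
  have hm : Measurable (fun x => weight α t x / x ^ (2 * n)) := measurable_weight.div (by fun_prop)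
  refine (intervalIntegrable_const (c := n.factorial / t ^ n)).mono_fun hm.aestronglyMeasurable ?_
  refine (ae_restrict_iff' measurableSet_uIoc).2 (.of_forall fun x hx => ?_)
  refine (norm_weight_div_pow_le hα ht hx n).trans (le_abs_self _)

theorem intervalIntegrable_weight_div_pow_three (hα : 0 < α) (ht : 0 < t) :
    IntervalIntegrable (fun x => weight α t x / x ^ 3) volume (-1) 1 := by
  refine ((intervalIntegrable_weight_div_pow hα ht 2).continuousOn_mul
    (g := fun x => x) (by fun_prop)).congr (fun x _ => ?_)
  rcases eq_or_ne x 0 with rfl | h0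
  · simp
  · rw [show 2 * 2 = 4 from rfl]
    field_simp

theorem intervalIntegrable_weight_div_sq (hα : 0 < α) (ht : 0 < t) :
    IntervalIntegrable (fun x => weight α t x / x ^ 2) volume (-1) 1 :=
  intervalIntegrable_weight_div_pow hα ht 1

/-- Used with b = α - 1, possibly negative. Near each endpoint one factor of (1-x)^b (1+x)^b is
singular and the other lies between powers of 1 and 2. -/
theorem intervalIntegrable_one_sub_sq_rpow {b : ℝ} (hb : -1 < b) :
    IntervalIntegrable (fun x : ℝ => (1 - x ^ 2) ^ b) volume (-1) 1 := by
  have i1 : IntervalIntegrable (fun x : ℝ => (1 - x) ^ b) volume (-1) 1 := by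
    have := (intervalIntegrable_rpow' (a := 2) (b := 0) hb).comp_sub_left 1
    norm_num at this
    exact this
  have i2 : IntervalIntegrable (fun x : ℝ => (1 + x) ^ b) volume (-1) 1 := by
    have := (intervalIntegrable_rpow' (a := 0) (b := 2) hb).comp_add_left 1
    norm_num at this
    exact this
  have hm : Measurable (fun x : ℝ => (1 - x ^ 2) ^ b) := by fun_prop
  refine ((i1.add i2).const_mul (1 + 2 ^ b)).mono_fun hm.aestronglyMeasurable ?_
  refine (ae_restrict_iff' measurableSet_uIoc).2 (.of_forall fun x hx => ?_)
  rw [Set.uIoc_of_le (by norm_num)] at hx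
  have ha : 0 ≤ 1 - x := by linarith [hx.2]
  have hb' : 0 ≤ 1 + x := by linarith [hx.1]
  have key : ∀ y : ℝ, 1 ≤ y → y ≤ 2 → y ^ b ≤ 1 + 2 ^ b := fun y h1 h2 => by
    rcases le_total 0 b with h | h
    · linarith [Real.rpow_le_rpow (by linarith) h2 h]
    · linarith [Real.rpow_le_one_of_one_le_of_nonpos h1 h, Real.rpow_pos_of_pos two_pos b]
  have n1 := Real.rpow_nonneg ha b
  have n2 := Real.rpow_nonneg hb' b
  have n3 := Real.rpow_pos_of_pos two_pos b
  beta_reduce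
  rw [show (1 - x ^ 2) = (1 - x) * (1 + x) by ring, Real.mul_rpow ha hb',
    Real.norm_of_nonneg (by positivity), Real.norm_of_nonneg (by positivity)]
  rcases le_total 0 x with h | h
  · nlinarith [key (1 + x) (by linarith) (by linarith [hx.2])]
  · nlinarith [key (1 - x) (by linarith) (by linarith [hx.1])]

theorem intervalIntegrable_weight_div_one_sub_sq (hα : 0 < α) (ht : 0 ≤ t) :
    IntervalIntegrable (fun x => weight α t x / (1 - x ^ 2)) volume (-1) 1 := by
  have hm : Measurable (fun x => weight α t x / (1 - x ^ 2)) :=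
    measurable_weight.div (by fun_prop)
  refine (intervalIntegrable_one_sub_sq_rpow (b := α - 1) (by linarith)).mono_fun
    hm.aestronglyMeasurable ?_
  refine (ae_restrict_iff' measurableSet_uIoc).2 (.of_forall fun x hx => ?_)
  rw [Set.uIoc_of_le (by norm_num)] at hx
  have hx' : x ∈ Set.Icc (-1 : ℝ) 1 := ⟨hx.1.le, hx.2⟩
  have h0 : 0 ≤ 1 - x ^ 2 := by nlinarith [hx.1, hx.2]
  beta_reduce
  rw [Real.norm_of_nonneg (div_nonneg (weight_nonneg hx') h0),
    Real.norm_of_nonneg (Real.rpow_nonneg h0 _)]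
  rcases h0.eq_or_lt with h | h
  · rw [← h]; simp [Real.rpow_nonneg]
  · rw [Real.rpow_sub_one h.ne', weight]
    refine div_le_div_of_nonneg_right ?_ h0
    refine mul_le_of_le_one_right (Real.rpow_nonneg h0 _) ?_
    exact Real.exp_le_one_iff.2 (neg_nonpos.2 (by positivity))

theorem hasDerivAt_weight {x : ℝ} (hx : x ∈ Set.Ioo (-1 : ℝ) 1) (hx0 : x ≠ 0) :
    HasDerivAt (weight α t)
      (-(2 * α * x * (weight α t x / (1 - x ^ 2))) + 2 * t * (weight α t x / x ^ 3)) x := by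
  have h0 : 0 < 1 - x ^ 2 := by nlinarith [hx.1, hx.2]
  have d1 : HasDerivAt (fun y : ℝ => 1 - y ^ 2) (-(2 * x)) x := by
    simpa using (hasDerivAt_pow 2 x).const_sub 1
  have d2 := d1.rpow_const (p := α) (Or.inl h0.ne')
  have d3 : HasDerivAt (fun y : ℝ => -(t / y ^ 2)) (2 * t / x ^ 3) x := by
    have := ((hasDerivAt_const x t).fun_div (hasDerivAt_pow 2 x) (by positivity)).fun_neg
    refine this.congr_deriv ?_
    push_cast
    field_simp
    ring
  refine (d2.fun_mul d3.exp).congr_deriv ?_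
  rw [Real.rpow_sub_one h0.ne', weight]
  field_simp

/-- With t / 0 = 0 the weight takes the value 1 at x = 0, although its limit there is 0; the update
restores continuity. -/
theorem continuousOn_update_weight (hα : 0 < α) (ht : 0 < t) :
    ContinuousOn (Function.update (weight α t) 0 0) (Set.Icc (-1) 1) := by
  intro x hx
  rcases eq_or_ne x 0 with rfl | h0
  · rw [ContinuousWithinAt, Function.update_self]
    have hlim : Filter.Tendsto (fun x : ℝ => 2 / t ^ 2 * x ^ 4) (nhdsWithin 0 (Set.Icc (-1) 1))
        (nhds 0) := by
      have : Continuous (fun x : ℝ => 2 / t ^ 2 * x ^ 4) := by fun_prop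
      simpa using (this.tendsto 0).mono_left nhdsWithin_le_nhds
    refine squeeze_zero' ?_ ?_ hlim
    · filter_upwards [self_mem_nhdsWithin] with y hy
      rcases eq_or_ne y 0 with rfl | h
      · simp
      · rw [Function.update_of_ne h]; exact weight_nonneg hy
    · filter_upwards [self_mem_nhdsWithin] with y hy
      rcases eq_or_ne y 0 with rfl | h
      · simp
      · rw [Function.update_of_ne h]
        have := weight_div_pow_le hα ht hy 2
        rw [show 2 * 2 = 4 from rfl, div_le_iff₀ (by positivity)] at this
        simpa using this
  · refine ContinuousAt.continuousWithinAt ?_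
    rw [continuousAt_update_of_ne h0]
    unfold weight
    refine ContinuousAt.mul ?_ ?_
    · exact ContinuousAt.rpow_const (by fun_prop) (Or.inr hα.le)
    · have : x ^ 2 ≠ 0 := by positivity
      fun_prop (disch := assumption)

theorem weight_one (hα : 0 < α) : weight α t 1 = 0 := by
  simp [weight, Real.zero_rpow hα.ne']

theorem weight_neg_one (hα : 0 < α) : weight α t (-1) = 0 := by
  simp [weight, Real.zero_rpow hα.ne']

/-- Integration by parts of f w. The boundary terms vanish because α > 0, and 0 is a countable
exceptional set for differentiability. -/
theorem pearson (hα : 0 < α) (ht : 0 < t) (f : ℝ[X]) :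
    polyIntegral _ (intervalIntegrable_weight hα ht.le) (derivative f)
      = 2 * α * polyIntegral _ (intervalIntegrable_weight_div_one_sub_sq hα ht.le) (X * f)
        - 2 * t * polyIntegral _ (intervalIntegrable_weight_div_pow_three hα ht) f := by
  have i1 := (intervalIntegrable_weight hα ht.le).continuousOn_mul
    (g := fun x => (derivative f).eval x) (by fun_prop)
  have i2 := ((intervalIntegrable_weight_div_one_sub_sq hα ht.le).continuousOn_mul
    (g := fun x => (X * f).eval x) (by fun_prop)).const_mul (2 * α)
  have i3 := ((intervalIntegrable_weight_div_pow_three hα ht).continuousOn_mul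
    (g := fun x => f.eval x) (by fun_prop)).const_mul (2 * t)
  have h := integral_eq_of_hasDerivAt_off_countable_of_le
    (fun x => f.eval x * Function.update (weight α t) 0 0 x)
    (fun x => (derivative f).eval x * weight α t x
      - 2 * α * ((X * f).eval x * (weight α t x / (1 - x ^ 2)))
      + 2 * t * (f.eval x * (weight α t x / x ^ 3)))
    (by norm_num : (-1 : ℝ) ≤ 1) (Set.countable_singleton (0 : ℝ))
    (by
      have := continuousOn_update_weight hα ht
      fun_prop)
    (fun x hx => by
      have hx0 : x ≠ 0 := hx.2
      have hu : Function.update (weight α t) 0 0 =ᶠ[nhds x] weight α t := by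
        filter_upwards [isOpen_ne.mem_nhds hx0] with y hy
        exact Function.update_of_ne hy _ _
      refine (((f.hasDerivAt x).fun_mul ((hasDerivAt_weight hx.1 hx0).congr_of_eventuallyEq
        hu)).congr_deriv ?_)
      rw [Function.update_of_ne hx0, eval_mul, eval_X]
      ring)
    ((i1.sub i2).add i3)
  rw [integral_add (i1.sub i2) i3, integral_sub i1 i2, intervalIntegral.integral_const_mul,
    intervalIntegral.integral_const_mul,
    Function.update_of_ne one_ne_zero, Function.update_of_ne (by norm_num), weight_one hα,
    weight_neg_one hα] at h
  simp only [polyIntegral_apply]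
  linarith

/-! ### The relations between R_n, r_n and the norms. -/

theorem isSymmOrtho_orthoPoly (hα : 0 < α) (ht : 0 ≤ t) :
    IsSymmOrtho (polyIntegral _ (intervalIntegrable_weight hα ht)) (orthoPoly α t) where
  monic := orthoPoly_monic α t
  natDegree := orthoPoly_natDegree α t
  orth n m hm := by
    simp only [polyIntegral_apply, eval_mul]
    exact innerW_orthoPoly_of_lt hα ht n m hm
  pos p hp := by
    simp only [polyIntegral_apply, eval_mul]
    exact innerW_self_pos hα ht hp
  odd p hp := by
    have h1 : ∀ x, p.eval (-x) = -p.eval x := fun x => by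
      have := congrArg (eval x) hp
      simpa using this
    have h2 := integral_comp_neg (a := -1) (b := 1) (fun x => p.eval x * weight α t x)
    simp only [h1, weight, neg_sq, neg_mul, intervalIntegral.integral_neg, neg_neg] at h2
    simp only [polyIntegral_apply, weight]
    linarith

theorem map_X_mul (hα : 0 < α) (ht : 0 < t) (p : ℝ[X]) :
    polyIntegral _ (intervalIntegrable_weight_div_pow_three hα ht) (X * p)
      = polyIntegral _ (intervalIntegrable_weight_div_sq hα ht) p := by
  refine polyIntegral_mul _ _ X (Set.countable_singleton 0) (fun x hx => ?_) p
  have hx : x ≠ 0 := hx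
  rw [eval_X]
  field_simp

theorem map_X_sq_mul (hα : 0 < α) (ht : 0 < t) (p : ℝ[X]) :
    polyIntegral _ (intervalIntegrable_weight_div_sq hα ht) (X ^ 2 * p)
      = polyIntegral _ (intervalIntegrable_weight hα ht.le) p := by
  refine polyIntegral_mul _ _ (X ^ 2) (Set.countable_singleton 0) (fun x hx => ?_) p
  have hx : x ≠ 0 := hx
  rw [eval_pow, eval_X]
  field_simp

theorem map_one_sub_X_sq_mul (hα : 0 < α) (ht : 0 ≤ t) (p : ℝ[X]) :
    polyIntegral _ (intervalIntegrable_weight_div_one_sub_sq hα ht) ((1 - X ^ 2) * p)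
      = polyIntegral _ (intervalIntegrable_weight hα ht) p := by
  refine polyIntegral_mul _ _ (1 - X ^ 2) ((Set.finite_singleton (-1)).insert 1).countable
    (fun x hx => ?_) p
  have hx0 : 1 - x ^ 2 ≠ 0 := fun h0 => hx (by
    have : (x - 1) * (x + 1) = 0 := by linarith
    rcases mul_eq_zero.1 this with h | h
    · left; linarith
    · right; rw [Set.mem_singleton_iff]; linarith)
  simp only [eval_sub, eval_one, eval_pow, eval_X]
  field_simp

theorem normSq_eq (hα : 0 < α) (ht : 0 ≤ t) (n : ℕ) :
    normSq α t n
      = polyIntegral _ (intervalIntegrable_weight hα ht) (orthoPoly α t n * orthoPoly α t n) := by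
  simp only [normSq, innerW, polyIntegral_apply, eval_mul]

theorem R_eq (hα : 0 < α) (ht : 0 < t) (n : ℕ) :
    R α t n = 2 * t / normSq α t n
      * polyIntegral _ (intervalIntegrable_weight_div_sq hα ht)
        (orthoPoly α t n * orthoPoly α t n) := by
  simp only [R, polyIntegral_apply, eval_mul, sq (eval _ _), mul_div_assoc]

theorem r_succ_eq (hα : 0 < α) (ht : 0 < t) (n : ℕ) :
    r α t (n + 1) = 2 * t / normSq α t n
      * polyIntegral _ (intervalIntegrable_weight_div_pow_three hα ht)
        (orthoPoly α t (n + 1) * orthoPoly α t n) := by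
  simp only [r, polyIntegral_apply, eval_mul, mul_div_assoc]

/-- Since x² ≤ 1, h_n ≤ Z(P_n²). Positivity is what permits the divisions in
`discriminant_relation`. -/
theorem R_pos (hα : 0 < α) (ht : 0 < t) (n : ℕ) : 0 < R α t n := by
  rw [R_eq hα ht]
  refine mul_pos (div_pos (by positivity) (normSq_pos hα ht.le n)) ?_
  refine lt_of_lt_of_le ((isSymmOrtho_orthoPoly hα ht.le).norm_pos n) ?_
  have i2 := intervalIntegrable_weight_div_sq hα ht
  rw [← map_X_sq_mul hα ht]
  simp only [polyIntegral_apply]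
  refine integral_mono_on (by norm_num) (i2.continuousOn_mul (by fun_prop))
    (i2.continuousOn_mul (by fun_prop)) fun x hx => ?_
  refine mul_le_mul_of_nonneg_right ?_ (div_nonneg (weight_nonneg hx) (sq_nonneg x))
  rw [eval_mul, eval_mul, eval_pow, eval_X]
  refine mul_le_of_le_one_left (mul_self_nonneg _) ?_
  nlinarith [hx.1, hx.2]

theorem R_eq_add (hα : 0 < α) (ht : 0 < t) (n : ℕ) : R α t n = r α t (n + 1) + r α t n := by
  have h := isSymmOrtho_orthoPoly hα ht.le
  have hV := map_X_mul hα ht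
  rw [R_eq hα ht, r_succ_eq hα ht]
  cases n with
  | zero =>
    rw [r, add_zero, h.one_eq, hV, h.zero_eq, mul_one]
  | succ n =>
    have e := h.three_term n
    have hpos := (normSq_pos hα ht.le n).ne'
    have hpos' := (normSq_pos hα ht.le (n + 1)).ne'
    have := congrArg (polyIntegral _ (intervalIntegrable_weight_div_pow_three hα ht))
      (congrArg (· * orthoPoly α t (n + 1)) e)
    simp only [sub_mul, map_sub, mul_assoc, map_C_mul, hV, ← normSq_eq hα ht.le] at this
    rw [r_succ_eq hα ht, this, mul_comm (orthoPoly α t (n + 1)) (orthoPoly α t n)]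
    field_simp
    ring

theorem normSq_mul_R_mul_R (hα : 0 < α) (ht : 0 < t) (n : ℕ) :
    normSq α t (n + 1) * R α t (n + 1) * R α t n
      = 2 * (-1) ^ n * t * r α t (n + 1) * normSq α t n := by
  have h := (isSymmOrtho_orthoPoly hα ht.le).Z_product (map_X_sq_mul hα ht) (map_X_mul hα ht) n
  have hpos := (normSq_pos hα ht.le n).ne'
  have hpos' := (normSq_pos hα ht.le (n + 1)).ne'
  rw [← normSq_eq hα ht.le] at h
  rw [R_eq hα ht, R_eq hα ht, r_succ_eq hα ht]
  field_simp
  linear_combination h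

theorem normSq_mul_shifted (hα : 0 < α) (ht : 0 < t) (n : ℕ) :
    normSq α t n * (n + 1 + r α t (n + 1)) * (n + 1 + 2 * α + r α t (n + 1))
      = normSq α t (n + 1) * (2 * n + 3 + 2 * α + R α t (n + 1)) * (2 * n + 1 + 2 * α + R α t n) := by
  have h := isSymmOrtho_orthoPoly hα ht.le
  have hM := map_one_sub_X_sq_mul hα ht.le
  have hp := h.M_product hM n
  have h1 := h.pearson_sq hM (map_X_mul hα ht) (pearson hα ht) n
  have h2 := h.pearson_sq hM (map_X_mul hα ht) (pearson hα ht) (n + 1)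
  have h3 := h.pearson_mul (pearson hα ht) n
  have hpos := (normSq_pos hα ht.le n).ne'
  have hpos' := (normSq_pos hα ht.le (n + 1)).ne'
  set M := polyIntegral _ (intervalIntegrable_weight_div_one_sub_sq hα ht.le)
  have f1 : normSq α t n * (2 * n + 1 + 2 * α + R α t n)
      = 2 * α * M (orthoPoly α t n * orthoPoly α t n) := by
    rw [h1, R_eq hα ht, ← normSq_eq hα ht.le]
    field_simp
  have f2 : normSq α t (n + 1) * (2 * n + 3 + 2 * α + R α t (n + 1))
      = 2 * α * M (orthoPoly α t (n + 1) * orthoPoly α t (n + 1)) := by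
    rw [h2, R_eq hα ht, ← normSq_eq hα ht.le]
    field_simp
    push_cast
    ring
  have f3 : normSq α t n * (n + 1 + r α t (n + 1))
      = 2 * α * M (X * orthoPoly α t (n + 1) * orthoPoly α t n) := by
    rw [h3, r_succ_eq hα ht, ← normSq_eq hα ht.le]
    field_simp
  have f4 : normSq α t n * (n + 1 + 2 * α + r α t (n + 1))
      = 2 * α * (M (X * orthoPoly α t (n + 1) * orthoPoly α t n) + normSq α t n) := by
    rw [mul_add (2 * α), ← f3]; ring
  refine mul_left_cancel₀ hpos ?_
  rw [← normSq_eq hα ht.le] at hp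
  calc _ = (normSq α t n * (n + 1 + r α t (n + 1)))
        * (normSq α t n * (n + 1 + 2 * α + r α t (n + 1))) := by ring
    _ = (normSq α t (n + 1) * (2 * n + 3 + 2 * α + R α t (n + 1)))
        * (normSq α t n * (2 * n + 1 + 2 * α + R α t n)) := by
      rw [f1, f2, f3, f4]; linear_combination 4 * α ^ 2 * hp
    _ = _ := by ring

theorem r_quadratic (hα : 0 < α) (ht : 0 < t) (n : ℕ) :
    (n + 1 + r α t (n + 1)) * (n + 1 + 2 * α + r α t (n + 1)) * R α t (n + 1) * R α t n
      - 2 * (-1) ^ n * t * r α t (n + 1) * (2 * n + 1 + 2 * α + R α t n)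
        * (2 * n + 3 + 2 * α + R α t (n + 1)) = 0 := by
  have h1 := normSq_mul_R_mul_R hα ht n
  have h2 := normSq_mul_shifted hα ht n
  refine mul_left_cancel₀ (normSq_pos hα ht.le n).ne' ?_
  linear_combination R α t (n + 1) * R α t n * h2
    + (2 * n + 1 + 2 * α + R α t n) * (2 * n + 3 + 2 * α + R α t (n + 1)) * h1

end SPJacobi

/-! ### Kummer's function: convergence, derivative, contiguous relations. -/

namespace SPJacobi

open Filter Topology

theorem ascPochhammer_eval_succ (a : ℝ) (k : ℕ) :
    (ascPochhammer ℝ (k + 1)).eval a = (ascPochhammer ℝ k).eval a * (a + k) :=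
  ascPochhammer_succ_eval k a

theorem ascPochhammer_eval_succ' (a : ℝ) (k : ℕ) :
    (ascPochhammer ℝ (k + 1)).eval a = a * (ascPochhammer ℝ k).eval (a + 1) := by
  rw [ascPochhammer_succ_left, eval_mul, eval_comp]
  simp

theorem ascPochhammer_eval_ne_zero {c : ℝ} (hc : ∀ k : ℕ, c + k ≠ 0) (k : ℕ) :
    (ascPochhammer ℝ k).eval c ≠ 0 := by
  induction k with
  | zero => simp
  | succ k ih => rw [ascPochhammer_eval_succ]; exact mul_ne_zero ih (hc k)

/-- The ratios (a+k)/(c+k) tend to 1, hence are bounded, so their products grow at most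
geometrically. -/
theorem exists_ascPochhammer_div_le (a : ℝ) {c : ℝ} (hc : ∀ k : ℕ, c + k ≠ 0) :
    ∃ K : ℝ, 0 ≤ K ∧ ∀ k : ℕ,
      |(ascPochhammer ℝ k).eval a / (ascPochhammer ℝ k).eval c| ≤ K ^ k := by
  have hlim : Tendsto (fun k : ℕ => |(a + k) / (c + k)|) atTop (𝓝 |1|) := by
    refine Tendsto.abs ?_
    have h1 : Tendsto (fun k : ℕ => c + (k : ℝ)) atTop atTop :=
      tendsto_atTop_add_const_left _ _ tendsto_natCast_atTop_atTop
    have h2 := (h1.inv_tendsto_atTop.const_mul (a - c)).const_add 1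
    simp only [mul_zero, add_zero] at h2
    refine h2.congr fun k => ?_
    have := hc k
    simp only [Pi.inv_apply]
    field_simp
    ring
  obtain ⟨K, hK⟩ := hlim.bddAbove_range
  have hK' : ∀ k : ℕ, |(a + k) / (c + k)| ≤ K := fun k => hK ⟨k, rfl⟩
  have hK0 : 0 ≤ K := (abs_nonneg _).trans (hK' 0)
  refine ⟨K, hK0, fun k => ?_⟩
  induction k with
  | zero => simp
  | succ k ih =>
    rw [ascPochhammer_eval_succ, ascPochhammer_eval_succ, mul_div_mul_comm, abs_mul, pow_succ]
    exact mul_le_mul ih (hK' k) (abs_nonneg _) (pow_nonneg hK0 _)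

theorem hasSum_Phi (a : ℝ) {c : ℝ} (hc : ∀ k : ℕ, c + k ≠ 0) (z : ℝ) :
    HasSum (fun k : ℕ => (ascPochhammer ℝ k).eval a / (ascPochhammer ℝ k).eval c
      * (z ^ k / (k.factorial : ℝ))) (Phi a c z) := by
  obtain ⟨K, hK0, hK⟩ := exists_ascPochhammer_div_le a hc
  refine Summable.hasSum ?_
  refine Summable.of_norm_bounded (Real.summable_pow_div_factorial (K * |z|)) fun k => ?_
  rw [norm_mul, Real.norm_eq_abs, Real.norm_eq_abs, abs_div (z ^ k), abs_pow, Nat.abs_cast, mul_pow,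
    mul_div_assoc]
  exact mul_le_mul_of_nonneg_right (hK k) (by positivity)

theorem Phi_zero (a c : ℝ) : Phi a c 0 = 1 := by
  rw [Phi, tsum_eq_single 0 (fun k hk => by simp [hk])]
  simp

theorem add_one_add_ne_zero {c : ℝ} (hc : ∀ k : ℕ, c + k ≠ 0) (k : ℕ) : c + 1 + k ≠ 0 := by
  have := hc (k + 1)
  push_cast at this
  rwa [add_assoc, add_comm (1 : ℝ)]

theorem hasDerivAt_Phi (a : ℝ) {c : ℝ} (hc : ∀ k : ℕ, c + k ≠ 0) (z : ℝ) :
    HasDerivAt (Phi a c) (a / c * Phi (a + 1) (c + 1) z) z := by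
  obtain ⟨K, hK0, hK⟩ := exists_ascPochhammer_div_le a hc
  set u : ℕ → ℝ := fun k => (ascPochhammer ℝ k).eval a / (ascPochhammer ℝ k).eval c with hu
  -- Termwise differentiation takes place on the ball of radius ρ around 0, which contains z.
  set ρ := |z| + 1 with hρ
  have hρ0 : 0 ≤ ρ := by positivity
  have hsum : Summable (fun k : ℕ => K ^ k * (k * ρ ^ (k - 1) / (k.factorial : ℝ))) := by
    rw [← summable_nat_add_iff 1]
    refine ((Real.summable_pow_div_factorial (K * ρ)).mul_left K).congr fun k => ?_
    rw [Nat.factorial_succ, Nat.add_sub_cancel]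
    push_cast
    field_simp
    ring_nf
  have h := hasDerivAt_tsum_of_isPreconnected (t := Metric.ball (0 : ℝ) ρ)
    (g := fun k y => u k * (y ^ k / (k.factorial : ℝ)))
    (g' := fun k y => u k * (k * y ^ (k - 1) / (k.factorial : ℝ)))
    hsum Metric.isOpen_ball (convex_ball _ _).isPreconnected
    (fun k y _ => ((hasDerivAt_pow k y).div_const _).const_mul _)
    (fun k y hy => by
      have hy' : |y| ≤ ρ := by simpa using (Metric.mem_ball.1 hy).le
      rw [norm_mul, Real.norm_eq_abs, Real.norm_eq_abs, abs_div (_ * _), abs_mul, abs_pow, Nat.abs_cast,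
        Nat.abs_cast]
      have := hK k
      gcongr)
    (Metric.mem_ball_self (by positivity)) (hasSum_Phi a hc 0).summable
    (by rw [Metric.mem_ball, dist_zero_right, Real.norm_eq_abs]; linarith : z ∈ _)
  refine h.congr_deriv ?_
  have hs : Summable (fun k : ℕ => u k * (k * z ^ (k - 1) / (k.factorial : ℝ))) := by
    refine Summable.of_norm_bounded hsum fun k => ?_
    rw [norm_mul, Real.norm_eq_abs, Real.norm_eq_abs, abs_div (_ * _), abs_mul, abs_pow, Nat.abs_cast,
      Nat.abs_cast]
    have := hK k
    have : |z| ≤ ρ := by linarith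
    gcongr
  rw [hs.tsum_eq_zero_add, Phi, ← tsum_mul_left]
  simp only [CharP.cast_eq_zero, zero_mul, zero_div, mul_zero, zero_add]
  refine tsum_congr fun k => ?_
  rw [hu]
  simp only
  rw [ascPochhammer_eval_succ', ascPochhammer_eval_succ', Nat.factorial_succ, Nat.add_sub_cancel]
  have h1 := ascPochhammer_eval_ne_zero (add_one_add_ne_zero hc) k
  have h2 : c ≠ 0 := by simpa using hc 0
  push_cast
  field_simp

theorem Phi_contiguous_lower (a : ℝ) {c : ℝ} (hc : ∀ k : ℕ, c + k ≠ 0) (z : ℝ) :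
    c * Phi a c z - a * Phi (a + 1) (c + 1) z = (c - a) * Phi a (c + 1) z := by
  have hc' := add_one_add_ne_zero hc
  refine (((hasSum_Phi a hc z).mul_left c).sub
    ((hasSum_Phi (a + 1) hc' z).mul_left a)).unique ?_
  convert! (hasSum_Phi a hc' z).mul_left (c - a) using 1
  funext k
  have h0 := hc k
  have h1 := ascPochhammer_eval_ne_zero hc k
  have h2 := ascPochhammer_eval_ne_zero hc' k
  have e1 := (ascPochhammer_eval_succ c k).symm.trans (ascPochhammer_eval_succ' c k)
  have e2 := (ascPochhammer_eval_succ a k).symm.trans (ascPochhammer_eval_succ' a k)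
  field_simp
  linear_combination -z ^ k * (ascPochhammer ℝ k).eval a * e1
    + z ^ k * (ascPochhammer ℝ k).eval c * e2

theorem Phi_contiguous_upper (a : ℝ) {c : ℝ} (hc : ∀ k : ℕ, c + k ≠ 0) (z : ℝ) :
    Phi (a + 1) c z - Phi a c z = z / c * Phi (a + 1) (c + 1) z := by
  have hc' := add_one_add_ne_zero hc
  have h := (hasSum_Phi (a + 1) hc z).sub (hasSum_Phi a hc z)
  rw [← hasSum_nat_add_iff' 1] at h
  simp only [Finset.range_one, Finset.sum_singleton, ascPochhammer_zero, eval_one, pow_zero,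
    sub_self, sub_zero] at h
  refine h.unique ?_
  convert! (hasSum_Phi (a + 1) hc' z).mul_left (z / c) using 1
  funext k
  have h1 := ascPochhammer_eval_ne_zero hc' k
  have h2 : c ≠ 0 := by simpa using hc 0
  rw [ascPochhammer_eval_succ' c, ascPochhammer_eval_succ' a, ascPochhammer_eval_succ,
    Nat.factorial_succ, pow_succ]
  push_cast
  field_simp
  ring

/-- The last factor is the derivative of Φ(a, c+1; ·), so this reads cΦ(a,c) = (c + z d/dz)
Φ(a,c+1). -/
theorem Phi_contiguous_deriv (a : ℝ) {c : ℝ} (hc : ∀ k : ℕ, c + k ≠ 0) (z : ℝ) :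
    c * Phi a c z
      = c * Phi a (c + 1) z + z * (a / (c + 1) * Phi (a + 1) (c + 1 + 1) z) := by
  have h1 := Phi_contiguous_lower a hc z
  have h2 := Phi_contiguous_upper a (add_one_add_ne_zero hc) z
  linear_combination h1 + a * h2

theorem Phi_contiguous_sub_one (a : ℝ) {c : ℝ} (hc : ∀ k : ℕ, c + k ≠ 0) (z : ℝ) :
    c * (c + 1) * Phi a c z = (c + 1) * (c - z) * Phi (a + 1) (c + 1) z
      + z * (a + 1) * Phi (a + 2) (c + 2) z := by
  have h1 := Phi_contiguous_upper a hc z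
  have h2 := Phi_contiguous_deriv (a + 1) hc z
  have h0 : c ≠ 0 := by simpa using hc 0
  have h0' : c + 1 ≠ 0 := by simpa using add_one_add_ne_zero hc 0
  rw [show a + 1 + 1 = a + 2 by ring, show c + 1 + 1 = c + 2 by ring] at h2
  field_simp at h1 h2
  linear_combination h2 - (c + 1) * h1

end SPJacobi

/-! ### Moments of the weight and their limits as t → 0. -/

namespace SPJacobi

open MeasureTheory Filter Topology

variable {α t : ℝ}

theorem hasDerivAt_integral_weight_div_pow (hα : 0 < α) (ht : 0 < t) {p : ℝ → ℝ}
    (hp : Continuous p) (k : ℕ) :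
    HasDerivAt (fun s => ∫ x in (-1 : ℝ)..1, p x * (weight α s x / x ^ (2 * k)))
      (-∫ x in (-1 : ℝ)..1, p x * (weight α t x / x ^ (2 * (k + 1)))) t := by
  have hm : ∀ s (j : ℕ), Measurable (fun x => p x * (weight α s x / x ^ j)) := fun s j =>
    hp.measurable.mul (measurable_weight.div (by fun_prop))
  have h := intervalIntegral.hasDerivAt_integral_of_dominated_loc_of_deriv_le
    -- On s > t/2 the bound of `norm_weight_div_pow_le` is uniform in s.
    (μ := volume) (a := -1) (b := 1) (x₀ := t) (s := Set.Ioi (t / 2))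
    (F := fun s x => p x * (weight α s x / x ^ (2 * k)))
    (F' := fun s x => -(p x * (weight α s x / x ^ (2 * (k + 1)))))
    (bound := fun x => ‖p x‖ * ((k + 1).factorial / (t / 2) ^ (k + 1)))
    (Ioi_mem_nhds (by linarith)) (.of_forall fun s => (hm s _).aestronglyMeasurable)
    ((intervalIntegrable_weight_div_pow hα ht k).continuousOn_mul hp.continuousOn)
    (hm t _).neg.aestronglyMeasurable
    (.of_forall fun x hx s hs => by
      have hs' : t / 2 < s := hs
      have hs0 : 0 < s := by linarith
      rw [norm_neg, norm_mul]
      refine mul_le_mul_of_nonneg_left ?_ (norm_nonneg _)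
      refine (norm_weight_div_pow_le hα hs0 hx (k + 1)).trans ?_
      gcongr)
    (Continuous.intervalIntegrable (by fun_prop) _ _)
    (.of_forall fun x hx s _ => by
      have d : HasDerivAt (fun s => weight α s x) (weight α s x * -(1 / x ^ 2)) s := by
        have := ((((hasDerivAt_id s).div_const (x ^ 2)).fun_neg).exp).const_mul ((1 - x ^ 2) ^ α)
        refine this.congr_deriv ?_
        simp only [weight, id]
        ring
      refine ((d.div_const _).const_mul (p x)).congr_deriv ?_
      rw [show 2 * (k + 1) = 2 * k + 2 by ring, pow_add]
      simp only [div_eq_mul_inv, mul_inv, one_mul]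
      ring)
  simpa only [intervalIntegral.integral_neg] using h.2

/-- The moment `∫_{-1}^{1} x² w(x,t) dx` in terms of the moments of order `0` and `-2`. -/
theorem second_moment (hα : 0 < α) (ht : 0 < t) :
    (3 + 2 * α) * ∫ x in (-1 : ℝ)..1, x ^ 2 * weight α t x
      = (1 - 2 * t) * (∫ x in (-1 : ℝ)..1, weight α t x)
        + 2 * t * ∫ x in (-1 : ℝ)..1, weight α t x / x ^ 2 := by
  have h := isSymmOrtho_orthoPoly hα ht.le
  have hM := map_one_sub_X_sq_mul hα ht.le
  have h0 := h.pearson_sq hM (map_X_mul hα ht) (pearson hα ht) 0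
  have h1 := h.pearson_sq hM (map_X_mul hα ht) (pearson hα ht) 1
  have h2 := hM 1
  have h3 := map_X_sq_mul hα ht 1
  rw [h.zero_eq] at h0
  rw [h.one_eq] at h1
  rw [mul_one] at h0 h2 h3
  rw [map_sub] at h2
  rw [← sq, h3] at h1
  simp only [polyIntegral_apply, eval_one, one_mul, eval_pow, eval_X] at h0 h1 h2
  push_cast at h0 h1
  linear_combination h0 - h1 - 2 * α * h2

/-- This is the t-derivative of `second_moment`: differentiation in t lowers the order of a moment
by two and changes its sign. -/
theorem fourth_inverse_moment (hα : 0 < α) (ht : 0 < t) :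
    2 * t * (∫ x in (-1 : ℝ)..1, weight α t x / x ^ 4)
      = (1 + 2 * t) * (∫ x in (-1 : ℝ)..1, weight α t x / x ^ 2)
        + (1 + 2 * α) * ∫ x in (-1 : ℝ)..1, weight α t x := by
  have d0 := hasDerivAt_integral_weight_div_pow hα ht (p := fun x => x ^ 2) (by fun_prop) 0
  have d1 := hasDerivAt_integral_weight_div_pow hα ht (p := fun _ => 1) (by fun_prop) 0
  have d2 := hasDerivAt_integral_weight_div_pow hα ht (p := fun _ => 1) (by fun_prop) 1
  have e : ∫ x in (-1 : ℝ)..1, x ^ 2 * (weight α t x / x ^ 2)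
      = ∫ x in (-1 : ℝ)..1, weight α t x := by
    refine integral_congr_off_countable (Set.countable_singleton (0 : ℝ)) fun x hx => ?_
    have hx : x ≠ 0 := hx
    field_simp
  simp only [Nat.reduceMul, Nat.reduceAdd, pow_zero, div_one, one_mul, e] at d0 d1 d2
  have l := d0.const_mul (3 + 2 * α)
  have dt := ((hasDerivAt_id t).const_mul 2)
  have r := ((dt.const_sub 1).fun_mul d1).fun_add (dt.fun_mul d2)
  have := l.unique (r.congr_of_eventuallyEq (by
    filter_upwards [Ioi_mem_nhds ht] with s hs
    exact second_moment hα hs))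
  simp only [id] at this
  linarith

/-- A Beta integral after x ↦ 2x - 1, simplified by the duplication formula. -/
theorem integral_one_sub_sq_rpow (hα : 0 < α) :
    ∫ x in (-1 : ℝ)..1, (1 - x ^ 2) ^ α
      = √Real.pi * Real.Gamma (1 + α) / Real.Gamma (3 / 2 + α) := by
  have hb : ∫ x in (0 : ℝ)..1, x ^ α * (1 - x) ^ α
      = Real.Gamma (1 + α) * Real.Gamma (1 + α) / Real.Gamma (2 * (1 + α)) := by
    have h := ProbabilityTheory.beta_eq_betaIntegralReal (1 + α) (1 + α)
      (by linarith) (by linarith)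
    rw [ProbabilityTheory.beta, ← two_mul] at h
    rw [h, Complex.betaIntegral]
    have e : ∫ x in (0 : ℝ)..1, (x : ℂ) ^ (((1 + α : ℝ) : ℂ) - 1) * (1 - (x : ℂ)) ^
        (((1 + α : ℝ) : ℂ) - 1) = ∫ x in (0 : ℝ)..1, ((x ^ α * (1 - x) ^ α : ℝ) : ℂ) := by
      refine intervalIntegral.integral_congr fun x hx => ?_
      rw [Set.uIcc_of_le zero_le_one] at hx
      rw [Complex.ofReal_mul, Complex.ofReal_cpow hx.1,
        Complex.ofReal_cpow (by linarith [hx.2] : 0 ≤ 1 - x)]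
      push_cast
      ring_nf
    rw [e, intervalIntegral.integral_ofReal, Complex.ofReal_re]
  have hs : ∫ x in (-1 : ℝ)..1, (1 - x ^ 2) ^ α
      = 2 * ∫ x in (0 : ℝ)..1, (1 - (2 * x - 1) ^ 2) ^ α := by
    rw [intervalIntegral.integral_comp_mul_sub (fun x => (1 - x ^ 2) ^ α) two_ne_zero 1, smul_eq_mul,
      mul_inv_cancel_left₀ two_ne_zero]
    norm_num
  have h4 : ∫ x in (0 : ℝ)..1, (1 - (2 * x - 1) ^ 2) ^ α
      = 4 ^ α * ∫ x in (0 : ℝ)..1, x ^ α * (1 - x) ^ α := by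
    rw [← intervalIntegral.integral_const_mul]
    refine intervalIntegral.integral_congr fun x hx => ?_
    rw [Set.uIcc_of_le zero_le_one] at hx
    rw [← Real.mul_rpow hx.1 (by linarith [hx.2]),
      ← Real.mul_rpow (by norm_num) (mul_nonneg hx.1 (by linarith [hx.2]))]
    ring_nf
  have hd := Real.Gamma_mul_Gamma_add_half (1 + α)
  rw [show 1 + α + 1 / 2 = 3 / 2 + α by ring] at hd
  have g1 : Real.Gamma (3 / 2 + α) ≠ 0 := (Real.Gamma_pos_of_pos (by linarith)).ne'
  have g2 : Real.Gamma (2 * (1 + α)) ≠ 0 := (Real.Gamma_pos_of_pos (by linarith)).ne'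
  have h2 : (4 : ℝ) ^ α * 2 * 2 ^ (1 - 2 * (1 + α)) = 1 := by
    rw [show (4 : ℝ) = 2 ^ (2 : ℝ) by norm_num, ← Real.rpow_mul (by norm_num),
      ← Real.rpow_add_one (by norm_num), ← Real.rpow_add (by norm_num)]
    ring_nf
    exact Real.rpow_zero 2
  rw [hs, h4, hb, eq_div_iff g1]
  generalize Real.Gamma (3 / 2 + α) = G at hd
  field_simp
  linear_combination 2 * 4 ^ α * hd + √Real.pi * Real.Gamma (2 * (1 + α)) * h2

theorem integral_eq_two_mul_of_even {f : ℝ → ℝ} (hf : ∀ x, f (-x) = f x)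
    (hi : IntervalIntegrable f volume (-1) 1) :
    ∫ x in (-1 : ℝ)..1, f x = 2 * ∫ x in (0 : ℝ)..1, f x := by
  have h1 : IntervalIntegrable f volume (-1) 0 :=
    hi.mono_set (by rw [Set.uIcc_of_le (by norm_num), Set.uIcc_of_le (by norm_num)]
                    exact Set.Icc_subset_Icc_right zero_le_one)
  have h2 : IntervalIntegrable f volume 0 1 :=
    hi.mono_set (by rw [Set.uIcc_of_le (by norm_num), Set.uIcc_of_le (by norm_num)]
                    exact Set.Icc_subset_Icc_left (by norm_num))
  have h3 := intervalIntegral.integral_comp_neg (a := 0) (b := 1) f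
  simp only [hf, neg_zero] at h3
  rw [← intervalIntegral.integral_add_adjacent_intervals h1 h2, ← h3]
  ring

/-- Substituting `v = s / x` in the moment of order `-2`. -/
theorem mul_integral_weight_div_sq (hα : 0 < α) {s : ℝ} (hs : 0 < s) :
    s * ∫ x in (-1 : ℝ)..1, weight α (s ^ 2) x / x ^ 2
      = 2 * ∫ v in Set.Ioi (0 : ℝ), max (1 - s ^ 2 / v ^ 2) 0 ^ α * Real.exp (-1 * v ^ 2) := by
  rw [integral_eq_two_mul_of_even (fun x => by simp [weight])
    (intervalIntegrable_weight_div_sq hα (by positivity))]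
  set H : ℝ → ℝ := fun x => (max (1 - s ^ 2 * x ^ 2) 0) ^ α * Real.exp (-(1 / x ^ 2)) / x ^ 2
    with hH
  have e1 : ∫ v in Set.Ioi (0 : ℝ), max (1 - s ^ 2 / v ^ 2) 0 ^ α * Real.exp (-1 * v ^ 2)
      = ∫ x in Set.Ioi (0 : ℝ), H x := by
    rw [← integral_comp_rpow_Ioi _ (by norm_num : (-1 : ℝ) ≠ 0)]
    refine setIntegral_congr_fun measurableSet_Ioi fun x hx => ?_
    have hx : 0 < x := hx
    simp only [smul_eq_mul, hH]
    rw [Real.rpow_neg_one, show (-1 : ℝ) - 1 = -(2 : ℕ) by norm_num, Real.rpow_neg hx.le,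
      Real.rpow_natCast, abs_neg, abs_one, inv_pow, div_inv_eq_mul, one_mul, neg_one_mul, one_div]
    ring
  have e2 : ∫ x in Set.Ioi (0 : ℝ), H x = s⁻¹ * ∫ x in Set.Ioi (0 : ℝ), H (s⁻¹ * x) := by
    rw [integral_comp_mul_left_Ioi _ _ (inv_pos.2 hs), mul_zero, inv_inv, smul_eq_mul,
      inv_mul_cancel_left₀ hs.ne']
  have e3 : ∫ x in Set.Ioi (0 : ℝ), H (s⁻¹ * x) = ∫ x in Set.Ioc (0 : ℝ) 1, H (s⁻¹ * x) := by
    refine setIntegral_eq_of_subset_of_forall_sdiff_eq_zero measurableSet_Ioi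
      Set.Ioc_subset_Ioi_self fun x hx => ?_
    have h1 : 1 < x := not_le.1 fun h => hx.2 ⟨hx.1, h⟩
    -- Beyond x = 1 the truncated base is 0, and 0^α = 0 as α > 0, so the half-line integral reduces
    -- to (0,1].
    have h2 : max (1 - s ^ 2 * (s⁻¹ * x) ^ 2) 0 = 0 := by
      refine max_eq_right ?_
      rw [mul_pow, inv_pow, mul_inv_cancel_left₀ (by positivity)]
      nlinarith
    simp only [hH, h2, Real.zero_rpow hα.ne', zero_mul, zero_div]
  have e4 : ∫ x in Set.Ioc (0 : ℝ) 1, H (s⁻¹ * x)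
      = ∫ x in Set.Ioc (0 : ℝ) 1, s ^ 2 * (weight α (s ^ 2) x / x ^ 2) := by
    refine setIntegral_congr_fun measurableSet_Ioc fun x hx => ?_
    have h2 : max (1 - s ^ 2 * (s⁻¹ * x) ^ 2) 0 = 1 - x ^ 2 := by
      rw [mul_pow, inv_pow, mul_inv_cancel_left₀ (by positivity)]
      refine max_eq_left ?_
      nlinarith [hx.1, hx.2]
    have hx0 : x ≠ 0 := hx.1.ne'
    have h3 : 1 / (s⁻¹ * x) ^ 2 = s ^ 2 / x ^ 2 := by field_simp
    simp only [hH, h2, h3, weight]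
    field_simp
  rw [e1, e2, e3, e4, integral_const_mul, intervalIntegral.integral_of_le zero_le_one]
  field_simp

/-- Dominated convergence to twice the half-line Gaussian integral; this is the initial value of J.
-/
theorem tendsto_mul_integral_weight_div_sq (hα : 0 < α) :
    Tendsto (fun s => s * ∫ x in (-1 : ℝ)..1, weight α (s ^ 2) x / x ^ 2) (𝓝[>] 0)
      (𝓝 √Real.pi) := by
  have hG : ∫ v in Set.Ioi (0 : ℝ), Real.exp (-1 * v ^ 2) = √Real.pi / 2 := by
    rw [integral_gaussian_Ioi, div_one]
  have key : Tendsto (fun s : ℝ => ∫ v in Set.Ioi (0 : ℝ),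
      max (1 - s ^ 2 / v ^ 2) 0 ^ α * Real.exp (-1 * v ^ 2)) (𝓝[>] 0) (𝓝 (√Real.pi / 2)) := by
    rw [← hG]
    refine tendsto_integral_filter_of_dominated_convergence (fun v => Real.exp (-1 * v ^ 2))
      (.of_forall fun s => ?_) (.of_forall fun s => .of_forall fun v => ?_)
      (integrable_exp_neg_mul_sq one_pos).integrableOn (.of_forall fun v => ?_)
    · exact Measurable.aestronglyMeasurable (by fun_prop)
    · have h1 : max (1 - s ^ 2 / v ^ 2) 0 ≤ 1 :=
        max_le (by have : 0 ≤ s ^ 2 / v ^ 2 := by positivity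
                   linarith) zero_le_one
      rw [norm_mul, Real.norm_of_nonneg (Real.rpow_nonneg (le_max_right _ _) _),
        Real.norm_of_nonneg (Real.exp_pos _).le]
      exact mul_le_of_le_one_left (Real.exp_pos _).le
        (Real.rpow_le_one (le_max_right _ _) h1 hα.le)
    · have hc : Continuous fun s : ℝ =>
          max (1 - s ^ 2 / v ^ 2) 0 ^ α * Real.exp (-1 * v ^ 2) := by
        refine Continuous.mul (Continuous.rpow_const (by fun_prop) fun _ => Or.inr hα.le) ?_
        fun_prop
      have := (hc.tendsto 0).mono_left (nhdsWithin_le_nhds (s := Set.Ioi 0))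
      simpa using this
  have h2 := key.const_mul 2
  rw [mul_div_cancel₀ _ two_ne_zero] at h2
  refine h2.congr' ?_
  filter_upwards [self_mem_nhdsWithin] with s hs
  exact (mul_integral_weight_div_sq hα hs).symm

theorem continuous_integral_weight_sq (hα : 0 < α) :
    Continuous fun s : ℝ => ∫ x in (-1 : ℝ)..1, weight α (s ^ 2) x := by
  refine intervalIntegral.continuous_of_dominated_interval (bound := fun _ => 1)
    (fun s => measurable_weight.aestronglyMeasurable) (fun s => .of_forall fun x hx => ?_)
    intervalIntegrable_const (.of_forall fun x _ => ?_)
  · rw [Set.uIoc_of_le (by norm_num)] at hx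
    have hx' : x ∈ Set.Icc (-1 : ℝ) 1 := ⟨hx.1.le, hx.2⟩
    rw [Real.norm_of_nonneg (weight_nonneg hx')]
    exact weight_le_one hα (sq_nonneg s) hx'
  · unfold weight
    fun_prop

/-- A Grönwall argument: the weighted energy E is nonincreasing, nonnegative and zero at 0. Only
continuity is required at s = 0, where differentiability of the moments is not available. -/
theorem eq_zero_of_linear_system {f g : ℝ → ℝ} {k : ℝ} (hk : 0 ≤ k)
    (hf : ContinuousOn f (Set.Ici 0)) (hg : ContinuousOn g (Set.Ici 0)) (hf0 : f 0 = 0)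
    (hg0 : g 0 = 0) (hf' : ∀ s > 0, HasDerivAt f (-2 * g s) s)
    (hg' : ∀ s > 0, HasDerivAt g (-2 * s * g s - k * f s) s) {s : ℝ} (hs : 0 ≤ s) :
    f s = 0 ∧ g s = 0 := by
  set E : ℝ → ℝ := fun s => (f s ^ 2 + g s ^ 2) * Real.exp (-(2 + k) * s) with hE
  have hd : ∀ s > 0, HasDerivAt E
      ((2 * f s * (-2 * g s) + 2 * g s * (-2 * s * g s - k * f s)) * Real.exp (-(2 + k) * s)
        + (f s ^ 2 + g s ^ 2) * (Real.exp (-(2 + k) * s) * -(2 + k))) s := fun s hs => by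
    have d1 := (hf' s hs).fun_pow 2
    have d2 := (hg' s hs).fun_pow 2
    have d3 := ((hasDerivAt_id s).const_mul (-(2 + k))).exp
    refine ((d1.fun_add d2).fun_mul d3).congr_deriv ?_
    simp only [id]
    push_cast
    ring
  have hanti : AntitoneOn E (Set.Ici 0) := by
    refine antitoneOn_of_deriv_nonpos (convex_Ici 0) ?_ ?_ ?_
    · exact ((hf.pow 2).add (hg.pow 2)).mul (by fun_prop)
    · intro x hx
      rw [interior_Ici] at hx
      exact (hd x hx).differentiableAt.differentiableWithinAt
    · intro x hx
      rw [interior_Ici] at hx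
      have hx : 0 < x := hx
      rw [(hd x hx).deriv]
      have e : (2 * f x * (-2 * g x) + 2 * g x * (-2 * x * g x - k * f x))
            * Real.exp (-(2 + k) * x) + (f x ^ 2 + g x ^ 2) * (Real.exp (-(2 + k) * x) * -(2 + k))
          = -(((2 + k) * (f x + g x) ^ 2 + 4 * x * g x ^ 2) * Real.exp (-(2 + k) * x)) := by ring
      rw [e, neg_nonpos]
      positivity
  have h0 : E 0 = 0 := by simp [hE, hf0, hg0]
  have h1 : E s ≤ 0 := h0 ▸ hanti (Set.self_mem_Ici) hs hs
  have h2 : f s ^ 2 + g s ^ 2 ≤ 0 := by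
    by_contra h
    exact absurd h1 (not_le.2 (mul_pos (not_le.1 h) (Real.exp_pos _)))
  constructor <;> nlinarith [sq_nonneg (f s), sq_nonneg (g s)]

end SPJacobi

/-! ### Identification of the moments with Kummer functions, and the initial values. -/

namespace SPJacobi

open MeasureTheory Filter Topology

variable {α t : ℝ}

theorem hasDerivAt_Phi_neg_sq (a : ℝ) {c : ℝ} (hc : ∀ k : ℕ, c + k ≠ 0) (s : ℝ) :
    HasDerivAt (fun s => Phi a c (-s ^ 2))
      (a / c * Phi (a + 1) (c + 1) (-s ^ 2) * -(2 * s)) s := by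
  refine HasDerivAt.comp (h := fun s => -s ^ 2) s (hasDerivAt_Phi a hc (-s ^ 2)) ?_
  simpa using (hasDerivAt_pow 2 s).fun_neg

theorem half_add_natCast_ne_zero (k : ℕ) : (1 / 2 : ℝ) + k ≠ 0 := by positivity

theorem three_halves_add_natCast_ne_zero (k : ℕ) : (3 / 2 : ℝ) + k ≠ 0 := by positivity

theorem neg_half_add_natCast_ne_zero (k : ℕ) : (-1 / 2 : ℝ) + k ≠ 0 := by
  rcases k with _ | k
  · norm_num
  · push_cast
    have : (0 : ℝ) ≤ k := k.cast_nonneg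
    linarith

/-- The combination of confluent hypergeometric functions proportional to
`∫_{-1}^{1} w(x, s²) dx`. -/
noncomputable def phiDen (α s : ℝ) : ℝ :=
  Real.Gamma (1 + α) * Phi (-1 / 2 - α) (1 / 2) (-s ^ 2)
    - 2 * s * Real.Gamma (3 / 2 + α) * Phi (-α) (3 / 2) (-s ^ 2)

/-- The combination of confluent hypergeometric functions proportional to
`s ∫_{-1}^{1} w(x, s²) / x² dx`. -/
noncomputable def phiNum (α s : ℝ) : ℝ :=
  Real.Gamma (3 / 2 + α) * Phi (-α) (1 / 2) (-s ^ 2)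
    - (1 + 2 * α) * s * Real.Gamma (1 + α) * Phi (1 / 2 - α) (3 / 2) (-s ^ 2)

theorem hasDerivAt_phiDen (α s : ℝ) : HasDerivAt (phiDen α) (-2 * phiNum α s) s := by
  have d1 := hasDerivAt_Phi_neg_sq (-1 / 2 - α) half_add_natCast_ne_zero s
  have d2 := hasDerivAt_Phi_neg_sq (-α) three_halves_add_natCast_ne_zero s
  have d3 := (((hasDerivAt_id s).const_mul 2).mul_const (Real.Gamma (3 / 2 + α))).fun_mul d2
  refine ((d1.const_mul (Real.Gamma (1 + α))).fun_sub d3).congr_deriv ?_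
  have h := Phi_contiguous_deriv (-α) half_add_natCast_ne_zero (-s ^ 2)
  rw [show (1 / 2 : ℝ) + 1 = 3 / 2 by norm_num] at h ⊢
  rw [phiNum, show -1 / 2 - α + 1 = 1 / 2 - α by ring]
  simp only [id]
  linear_combination 4 * Real.Gamma (3 / 2 + α) * h

theorem hasDerivAt_phiNum (α s : ℝ) :
    HasDerivAt (phiNum α) (-2 * s * phiNum α s - (1 + 2 * α) * phiDen α s) s := by
  have d1 := hasDerivAt_Phi_neg_sq (-α) half_add_natCast_ne_zero s
  have d2 := hasDerivAt_Phi_neg_sq (1 / 2 - α) three_halves_add_natCast_ne_zero s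
  have d3 := (((hasDerivAt_id s).const_mul (1 + 2 * α)).mul_const (Real.Gamma (1 + α))).fun_mul d2
  refine ((d1.const_mul (Real.Gamma (3 / 2 + α))).fun_sub d3).congr_deriv ?_
  have h1 := Phi_contiguous_lower (-α) half_add_natCast_ne_zero (-s ^ 2)
  have h2 := Phi_contiguous_upper (-1 / 2 - α) half_add_natCast_ne_zero (-s ^ 2)
  have h3 := Phi_contiguous_deriv (1 / 2 - α) half_add_natCast_ne_zero (-s ^ 2)
  rw [show (1 / 2 : ℝ) + 1 = 3 / 2 by norm_num] at *
  rw [show -1 / 2 - α + 1 = 1 / 2 - α by ring] at h2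
  rw [phiNum, phiDen]
  simp only [id]
  linear_combination 4 * s * Real.Gamma (3 / 2 + α) * h1
    + (1 + 2 * α) * Real.Gamma (1 + α) * (2 * h3 - h2)

/-- The substitution t = s² turns √t into s and gives both pairs the same linear system with finite
data at s = 0. -/
theorem phiDen_eq_and_phiNum_eq (hα : 0 < α) {s : ℝ} (hs : 0 ≤ s) :
    phiDen α s = Real.Gamma (3 / 2 + α) / √Real.pi * (∫ x in (-1 : ℝ)..1, weight α (s ^ 2) x) ∧
    (0 < s → phiNum α s = Real.Gamma (3 / 2 + α) / √Real.pi
      * (s * ∫ x in (-1 : ℝ)..1, weight α (s ^ 2) x / x ^ 2)) := by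
  set c := Real.Gamma (3 / 2 + α) / √Real.pi with hc
  have hpi : √Real.pi ≠ 0 := (Real.sqrt_pos.2 Real.pi_pos).ne'
  have hG : Real.Gamma (3 / 2 + α) ≠ 0 := (Real.Gamma_pos_of_pos (by linarith)).ne'
  set F : ℝ → ℝ := fun s => ∫ x in (-1 : ℝ)..1, weight α (s ^ 2) x with hF
  set J : ℝ → ℝ := fun s => s * ∫ x in (-1 : ℝ)..1, weight α (s ^ 2) x / x ^ 2 with hJ
  have hFd : ∀ s > 0, HasDerivAt F (-2 * J s) s := fun s hs => by
    have d := hasDerivAt_integral_weight_div_pow hα (t := s ^ 2) (by positivity)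
      (p := fun _ => 1) (by fun_prop) 0
    simp only [Nat.reduceMul, Nat.reduceAdd, pow_zero, div_one, one_mul] at d
    refine (HasDerivAt.comp (h := fun s => s ^ 2) s d (hasDerivAt_pow 2 s)).congr_deriv ?_
    rw [hJ]
    push_cast
    ring
  have hJd : ∀ s > 0, HasDerivAt J (-2 * s * J s - (1 + 2 * α) * F s) s := fun s hs => by
    have d := hasDerivAt_integral_weight_div_pow hα (t := s ^ 2) (by positivity)
      (p := fun _ => 1) (by fun_prop) 1
    simp only [Nat.reduceMul, Nat.reduceAdd, one_mul] at d
    refine ((hasDerivAt_id s).fun_mul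
      (HasDerivAt.comp (h := fun s => s ^ 2) s d (hasDerivAt_pow 2 s))).congr_deriv ?_
    have h := fourth_inverse_moment hα (t := s ^ 2) (by positivity)
    simp only [id, hJ, hF, Function.comp_apply]
    push_cast
    linear_combination -h
  -- Literally J(0) = 0, whereas J(s) → √π; K is the continuous extension.
  set K := Function.update J 0 √Real.pi with hK
  have hKJ : ∀ s > 0, K s = J s := fun s hs => Function.update_of_ne hs.ne' _ _
  have hKd : ∀ s > 0, HasDerivAt K (-2 * s * J s - (1 + 2 * α) * F s) s := fun s hs =>
    (hJd s hs).congr_of_eventuallyEq (by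
      filter_upwards [Ioi_mem_nhds hs] with y hy using hKJ y hy)
  have hKc : ContinuousOn K (Set.Ici 0) := by
    intro s hs
    rcases (Set.mem_Ici.1 hs).eq_or_lt with rfl | hs
    · rw [hK, continuousWithinAt_update_same, Set.Ici_sdiff_left]
      exact tendsto_mul_integral_weight_div_sq hα
    · exact (hKd s hs).continuousAt.continuousWithinAt
  have hDc : Continuous (phiDen α) :=
    continuous_iff_continuousAt.2 fun s => (hasDerivAt_phiDen α s).continuousAt
  have hNc : Continuous (phiNum α) :=
    continuous_iff_continuousAt.2 fun s => (hasDerivAt_phiNum α s).continuousAt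
  have h := eq_zero_of_linear_system (f := fun s => c * F s - phiDen α s)
    (g := fun s => c * K s - phiNum α s) (k := 1 + 2 * α) (by linarith)
    ((((continuous_integral_weight_sq hα).const_mul c).sub hDc).continuousOn)
    ((hKc.const_mul c).sub hNc.continuousOn)
    (by
      have : F 0 = √Real.pi * Real.Gamma (1 + α) / Real.Gamma (3 / 2 + α) := by
        rw [← integral_one_sub_sq_rpow hα]
        simp [hF, weight]
      rw [this, phiDen, hc]
      simp only [ne_eq, OfNat.ofNat_ne_zero, not_false_eq_true, zero_pow, neg_zero, Phi_zero,
        mul_zero, zero_mul, mul_one, sub_zero]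
      field_simp
      ring)
    (by
      rw [hK, Function.update_self, phiNum, hc]
      simp only [ne_eq, OfNat.ofNat_ne_zero, not_false_eq_true, zero_pow, neg_zero, Phi_zero,
        mul_zero, zero_mul, mul_one, sub_zero]
      field_simp
      ring)
    (fun s hs => (((hFd s hs).const_mul c).fun_sub (hasDerivAt_phiDen α s)).congr_deriv (by
      rw [hKJ s hs]; ring))
    (fun s hs => (((hKd s hs).const_mul c).fun_sub (hasDerivAt_phiNum α s)).congr_deriv (by
      rw [hKJ s hs]; ring)) hs
  refine ⟨by linarith [h.1], fun hs' => ?_⟩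
  have h2 := h.2
  simp only [hKJ s hs'] at h2
  linarith

/-- The bracket on the right is the Kummer counterpart of the right side of `second_moment`, so the
left side is a multiple of ∫ x² w. -/
theorem phi_second_moment (α s : ℝ) (hα : 0 < α) :
    3 * Real.Gamma (1 + α) * Phi (-3 / 2 - α) (-1 / 2) (-s ^ 2)
        + 8 * s ^ 2 * s * Real.Gamma (5 / 2 + α) * Phi (-α) (5 / 2) (-s ^ 2)
      = 3 * ((1 - 2 * s ^ 2) * phiDen α s + 2 * s * phiNum α s) := by
  have hG : Real.Gamma (5 / 2 + α) = (3 / 2 + α) * Real.Gamma (3 / 2 + α) := by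
    rw [← Real.Gamma_add_one (by linarith)]
    ring_nf
  have h1 := Phi_contiguous_sub_one (-3 / 2 - α) neg_half_add_natCast_ne_zero (-s ^ 2)
  have h2 := Phi_contiguous_deriv (-α) half_add_natCast_ne_zero (-s ^ 2)
  have h3 := Phi_contiguous_lower (-α) three_halves_add_natCast_ne_zero (-s ^ 2)
  rw [show (-1 / 2 : ℝ) + 1 = 1 / 2 by norm_num, show (-1 / 2 : ℝ) + 2 = 3 / 2 by norm_num,
    show -3 / 2 - α + 1 = -1 / 2 - α by ring, show -3 / 2 - α + 2 = 1 / 2 - α by ring] at h1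
  rw [show (1 / 2 : ℝ) + 1 = 3 / 2 by norm_num, show (3 / 2 : ℝ) + 1 = 5 / 2 by norm_num] at h2
  rw [show (3 / 2 : ℝ) + 1 = 5 / 2 by norm_num] at h3
  rw [hG, phiDen, phiNum]
  linear_combination -12 * Real.Gamma (1 + α) * h1
    - 12 * s * Real.Gamma (3 / 2 + α) * h2 - 8 * s ^ 3 * Real.Gamma (3 / 2 + α) * h3

theorem orthoPoly_zero (hα : 0 < α) (ht : 0 ≤ t) : orthoPoly α t 0 = 1 :=
  (isSymmOrtho_orthoPoly hα ht).zero_eq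

theorem orthoPoly_one (hα : 0 < α) (ht : 0 ≤ t) : orthoPoly α t 1 = X :=
  (isSymmOrtho_orthoPoly hα ht).one_eq

theorem integral_weight_pos (hα : 0 < α) (ht : 0 ≤ t) : 0 < ∫ x in (-1 : ℝ)..1, weight α t x := by
  simpa [normSq, innerW, orthoPoly_zero hα ht] using normSq_pos hα ht 0

theorem integral_sq_mul_weight_pos (hα : 0 < α) (ht : 0 ≤ t) :
    0 < ∫ x in (-1 : ℝ)..1, x ^ 2 * weight α t x := by
  simpa [normSq, innerW, orthoPoly_one hα ht, ← sq] using normSq_pos hα ht 1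

theorem R_zero_eq (hα : 0 < α) (ht : 0 ≤ t) :
    R α t 0 = 2 * t / (∫ x in (-1 : ℝ)..1, weight α t x)
      * ∫ x in (-1 : ℝ)..1, weight α t x / x ^ 2 := by
  simp [R, normSq, innerW, orthoPoly_zero hα ht]

theorem R_one_eq (hα : 0 < α) (ht : 0 ≤ t) :
    R α t 1 = 2 * t / (∫ x in (-1 : ℝ)..1, x ^ 2 * weight α t x)
      * ∫ x in (-1 : ℝ)..1, weight α t x := by
  simp only [R, normSq, innerW, orthoPoly_one hα ht, eval_X, ← sq]
  congr 1
  refine integral_congr_off_countable (Set.countable_singleton (0 : ℝ)) fun x hx => ?_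
  have hx : x ≠ 0 := hx
  field_simp

theorem phiDen_sqrt (α : ℝ) (ht : 0 ≤ t) :
    Real.Gamma (1 + α) * Phi (-1 / 2 - α) (1 / 2) (-t)
      - 2 * √t * Real.Gamma (3 / 2 + α) * Phi (-α) (3 / 2) (-t) = phiDen α √t := by
  rw [phiDen, Real.sq_sqrt ht]

theorem phiNum_sqrt (α : ℝ) (ht : 0 ≤ t) :
    Real.Gamma (3 / 2 + α) * Phi (-α) (1 / 2) (-t)
      - (1 + 2 * α) * √t * Real.Gamma (1 + α) * Phi (1 / 2 - α) (3 / 2) (-t) = phiNum α √t := by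
  rw [phiNum, Real.sq_sqrt ht]

theorem Gamma_div_sqrt_pi_pos (hα : 0 < α) : 0 < Real.Gamma (3 / 2 + α) / √Real.pi :=
  div_pos (Real.Gamma_pos_of_pos (by linarith)) (Real.sqrt_pos.2 Real.pi_pos)

theorem phiDen_sqrt_eq (hα : 0 < α) (ht : 0 ≤ t) :
    phiDen α √t = Real.Gamma (3 / 2 + α) / √Real.pi * ∫ x in (-1 : ℝ)..1, weight α t x := by
  have := (phiDen_eq_and_phiNum_eq hα (Real.sqrt_nonneg t)).1
  rwa [Real.sq_sqrt ht] at this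

theorem phiNum_sqrt_eq (hα : 0 < α) (ht : 0 < t) :
    phiNum α √t = Real.Gamma (3 / 2 + α) / √Real.pi
      * (√t * ∫ x in (-1 : ℝ)..1, weight α t x / x ^ 2) := by
  have := (phiDen_eq_and_phiNum_eq hα (Real.sqrt_nonneg t)).2 (Real.sqrt_pos.2 ht)
  rwa [Real.sq_sqrt ht.le] at this

theorem phiDen_sqrt_ne_zero (hα : 0 < α) (ht : 0 ≤ t) : phiDen α √t ≠ 0 := by
  rw [phiDen_sqrt_eq hα ht]
  exact (mul_pos (Gamma_div_sqrt_pi_pos hα) (integral_weight_pos hα ht)).ne'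

theorem R_zero_eq_phi (hα : 0 < α) (ht : 0 ≤ t) :
    R α t 0 = 2 * √t * phiNum α √t / phiDen α √t := by
  rcases ht.eq_or_lt with rfl | ht
  · simp [R]
  have h1 := (integral_weight_pos hα ht.le).ne'
  have h2 := (Gamma_div_sqrt_pi_pos hα).ne'
  rw [R_zero_eq hα ht.le, phiDen_sqrt_eq hα ht.le, phiNum_sqrt_eq hα ht]
  generalize Real.Gamma (3 / 2 + α) / √Real.pi = c at h2
  have h3 := Real.mul_self_sqrt ht.le
  field_simp
  linear_combination -(∫ x in (-1 : ℝ)..1, weight α t x / x ^ 2) * h3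

/-- The combination of confluent hypergeometric functions proportional to
`∫_{-1}^{1} x² w(x, t) dx`. -/
theorem phi_second_moment_eq (hα : 0 < α) (ht : 0 < t) :
    3 * Real.Gamma (1 + α) * Phi (-3 / 2 - α) (-1 / 2) (-t)
        + 8 * t * √t * Real.Gamma (5 / 2 + α) * Phi (-α) (5 / 2) (-t)
      = 3 * (3 + 2 * α) * (Real.Gamma (3 / 2 + α) / √Real.pi)
        * ∫ x in (-1 : ℝ)..1, x ^ 2 * weight α t x := by
  have h := phi_second_moment α √t hα
  have h3 := Real.mul_self_sqrt ht.le
  rw [phiDen_sqrt_eq hα ht.le, phiNum_sqrt_eq hα ht, Real.sq_sqrt ht.le] at h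
  rw [h]
  have h4 := second_moment hα ht
  generalize Real.Gamma (3 / 2 + α) / √Real.pi = c
  linear_combination -3 * c * h4
    + 6 * c * (∫ x in (-1 : ℝ)..1, weight α t x / x ^ 2) * h3

theorem phi_second_moment_ne_zero (hα : 0 < α) (ht : 0 ≤ t) :
    3 * Real.Gamma (1 + α) * Phi (-3 / 2 - α) (-1 / 2) (-t)
      + 8 * t * √t * Real.Gamma (5 / 2 + α) * Phi (-α) (5 / 2) (-t) ≠ 0 := by
  rcases ht.eq_or_lt with rfl | ht
  · simp [Phi_zero, (Real.Gamma_pos_of_pos (by linarith : 0 < 1 + α)).ne']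
  · rw [phi_second_moment_eq hα ht]
    have := Gamma_div_sqrt_pi_pos hα
    have := integral_sq_mul_weight_pos hα ht.le
    positivity

theorem R_one_eq_phi (hα : 0 < α) (ht : 0 ≤ t) :
    R α t 1 = 6 * t * ((3 + 2 * α) * phiDen α √t)
      / (3 * Real.Gamma (1 + α) * Phi (-3 / 2 - α) (-1 / 2) (-t)
        + 8 * t * √t * Real.Gamma (5 / 2 + α) * Phi (-α) (5 / 2) (-t)) := by
  rcases ht.eq_or_lt with rfl | ht
  · simp [R]
  have h1 := (integral_sq_mul_weight_pos hα ht.le).ne'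
  have h2 := (Gamma_div_sqrt_pi_pos hα).ne'
  rw [R_one_eq hα ht.le, phi_second_moment_eq hα ht, phiDen_sqrt_eq hα ht.le]
  generalize Real.Gamma (3 / 2 + α) / √Real.pi = c at h2
  have h3 : 3 + 2 * α ≠ 0 := by positivity
  field_simp
  ring

theorem r_one_eq (hα : 0 < α) (ht : 0 ≤ t) : r α t 1 = R α t 0 := by
  rcases ht.eq_or_lt with rfl | ht
  · simp [r, R]
  · rw [R_eq_add hα ht 0]
    simp [r]

theorem r_difference_equation (hα : 0 < α) (ht : 0 < t) (n : ℕ) :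
    (n + 1 + r α t (n + 1)) * (n + 1 + 2 * α + r α t (n + 1))
        * (r α t (n + 2) + r α t (n + 1)) * (r α t (n + 1) + r α t n)
      - 2 * (-1) ^ n * t * r α t (n + 1) * (2 * n + 1 + 2 * α + r α t (n + 1) + r α t n)
        * (2 * n + 3 + 2 * α + r α t (n + 2) + r α t (n + 1)) = 0 := by
  have h := r_quadratic hα ht n
  rw [R_eq_add hα ht, R_eq_add hα ht n] at h
  linear_combination h

end SPJacobi

theorem theorem2p2 (α t : ℝ) (hα : 0 < α) (ht : 0 ≤ t)
    (r R : ℕ → ℝ) (hr : r = SPJacobi.r α t) (hR : R = SPJacobi.R α t) :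
    -- the second-order difference equation for `r_n`
    (∀ n : ℕ, 1 ≤ n →
      (n + r n) * (n + 2 * α + r n) * (r (n + 1) + r n) * (r n + r (n - 1))
        + 2 * (-1) ^ n * t * r n * (2 * n - 1 + 2 * α + r n + r (n - 1))
          * (2 * n + 1 + 2 * α + r (n + 1) + r n) = 0) ∧
    -- the second-order difference equation for `R_n`
    (∀ n : ℕ, 1 ≤ n →
      ((R (n + 1) * R n ^ 4
          + 2 * ((2 * n + 2 * α + 1) * R (n + 1)
              - (-1) ^ n * t * (2 * n + 2 * α + 3)) * R n ^ 3
          + ((4 * n ^ 2 + 4 * n * (2 * α + 1) - 2 * t ^ 2 + 2 * (-1) ^ n * t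
                + 2 * α ^ 2 + 4 * α + 1) * R (n + 1)
              - 2 * t * (2 * n + 2 * α + 3) * (t + (-1) ^ n * (3 * n + 3 * α + 1))) * R n ^ 2
          + 2 * t * (2 * n + 2 * α + 1)
              * (((-1) ^ n - 2 * t) * R (n + 1)
                - (2 * n + 2 * α + 3) * (2 * t + (-1) ^ n * (n + α))) * R n
          - 2 * t ^ 2 * (2 * n + 2 * α + 1) ^ 2 * (2 * n + 2 * α + 3 + R (n + 1))) * R (n - 1)
        + 2 * t * (2 * n + 2 * α - 1) * (2 * n + 2 * α + 1 + R n)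
          * ((-1) ^ n * R (n + 1) * R n ^ 2
            + (((-1) ^ n * (n + α + 1) - t) * R (n + 1) - t * (2 * n + 2 * α + 3)) * R n
            - t * (2 * n + 2 * α + 1) * (2 * n + 2 * α + 3 + R (n + 1)))) ^ 2
      = 4 * (((-1) ^ n * t * (2 * n + 2 * α - 1) * (2 * n + 2 * α + 1 + R n)
              + ((n + α + (-1) ^ n * t) * R n
                + (-1) ^ n * t * (2 * n + 2 * α + 1)) * R (n - 1)) ^ 2
            - n * (n + 2 * α) * R (n - 1) ^ 2 * R n ^ 2)
          * (((-1) ^ n * t * (2 * n + 2 * α + 1) * (2 * n + 2 * α + 3 + R (n + 1))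
              - ((n + α + 1 - (-1) ^ n * t) * R (n + 1)
                - (-1) ^ n * t * (2 * n + 2 * α + 3)) * R n) ^ 2
            - (n + 1) * (n + 2 * α + 1) * R n ^ 2 * R (n + 1) ^ 2)) ∧
    -- the initial conditions (the denominators do not vanish)
    r 0 = 0 ∧
    r 1 = R 0 ∧
    Real.Gamma (1 + α) * SPJacobi.Phi (-1 / 2 - α) (1 / 2) (-t)
        - 2 * √t * Real.Gamma (3 / 2 + α) * SPJacobi.Phi (-α) (3 / 2) (-t) ≠ 0 ∧
    R 0 =
      2 * √t * (Real.Gamma (3 / 2 + α) * SPJacobi.Phi (-α) (1 / 2) (-t)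
          - (1 + 2 * α) * √t * Real.Gamma (1 + α) * SPJacobi.Phi (1 / 2 - α) (3 / 2) (-t))
        / (Real.Gamma (1 + α) * SPJacobi.Phi (-1 / 2 - α) (1 / 2) (-t)
          - 2 * √t * Real.Gamma (3 / 2 + α) * SPJacobi.Phi (-α) (3 / 2) (-t)) ∧
    3 * Real.Gamma (1 + α) * SPJacobi.Phi (-3 / 2 - α) (-1 / 2) (-t)
        + 8 * t * √t * Real.Gamma (5 / 2 + α) * SPJacobi.Phi (-α) (5 / 2) (-t) ≠ 0 ∧
    R 1 =
      6 * t * ((3 + 2 * α) * Real.Gamma (1 + α) * SPJacobi.Phi (-1 / 2 - α) (1 / 2) (-t)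
          - 4 * √t * Real.Gamma (5 / 2 + α) * SPJacobi.Phi (-α) (3 / 2) (-t))
        / (3 * Real.Gamma (1 + α) * SPJacobi.Phi (-3 / 2 - α) (-1 / 2) (-t)
          + 8 * t * √t * Real.Gamma (5 / 2 + α) * SPJacobi.Phi (-α) (5 / 2) (-t)) := by 
  subst hr hR
  rcases ht.eq_or_lt with rfl | ht'
  · have hr0 : ∀ n, SPJacobi.r α 0 n = 0 := by
      rintro (_ | n) <;> simp [SPJacobi.r]
    have hR0 : ∀ n, SPJacobi.R α 0 n = 0 := fun n => by simp [SPJacobi.R]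
    refine ⟨fun n _ => by simp [hr0], fun n _ => by simp [hR0], hr0 0, by rw [hr0, hR0], ?_, ?_,
      SPJacobi.phi_second_moment_ne_zero hα le_rfl, ?_⟩
    · rw [SPJacobi.phiDen_sqrt α le_rfl]
      exact SPJacobi.phiDen_sqrt_ne_zero hα le_rfl
    · simp [hR0]
    · simp [hR0]
  refine ⟨fun n hn => ?_, fun n hn => ?_, rfl, SPJacobi.r_one_eq hα ht, ?_, ?_,
    SPJacobi.phi_second_moment_ne_zero hα ht, ?_⟩
  · obtain ⟨m, rfl⟩ : ∃ m, n = m + 1 := ⟨n - 1, by omega⟩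
    have h := SPJacobi.r_difference_equation hα ht' m
    simp only [Nat.add_sub_cancel]
    push_cast
    -- With n = m + 1, (-1)^n = -(-1)^m, which accounts for the opposite sign in
    -- `r_difference_equation`.
    rw [pow_succ]
    linear_combination h
  · obtain ⟨m, rfl⟩ : ∃ m, n = m + 1 := ⟨n - 1, by omega⟩
    have h1 := SPJacobi.r_quadratic hα ht' m
    have h2 := SPJacobi.r_quadratic hα ht' (m + 1)
    have h3 := SPJacobi.R_eq_add hα ht' (m + 1)
    simp only [Nat.add_sub_cancel]
    refine SPJacobi.discriminant_relation (r := SPJacobi.r α t (m + 1))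
      (r' := SPJacobi.r α t (m + 1 + 1)) (SPJacobi.R_pos hα ht' m).ne'
      (SPJacobi.R_pos hα ht' (m + 1)).ne' (SPJacobi.R_pos hα ht' (m + 1 + 1)).ne'
      (neg_one_pow_eq_or ℝ _) ?_ ?_ h3
    · push_cast
      rw [pow_succ]
      linear_combination h1
    · push_cast at h2 ⊢
      linear_combination h2
  · rw [SPJacobi.phiDen_sqrt α ht]
    exact SPJacobi.phiDen_sqrt_ne_zero hα ht
  · rw [SPJacobi.phiDen_sqrt α ht, SPJacobi.phiNum_sqrt α ht]
    exact SPJacobi.R_zero_eq_phi hα ht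
  -- Since Γ(5/2+α) = (3/2+α) Γ(3/2+α), the displayed numerator is (3+2α) times `phiDen`.
  · rw [SPJacobi.R_one_eq_phi hα ht, ← SPJacobi.phiDen_sqrt α ht,
      show 5 / 2 + α = 3 / 2 + α + 1 by ring, Real.Gamma_add_one (by linarith)]
    ring_nf
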